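/- Let $\mathcal X$ be a Polish space with its Borel $\sigma$-algebra and let $(\Omega,\mathcal F,(\mathcal F_t)_{t\ge 0},(X_t)_{t\ge 0},(P^x)_{x\in\mathcal X})$ be a time-homogeneous c\`adl\`ag Markov family on $\mathcal X$ with transition probability kernels $p_t(x,dy)$; that is: $X$ is an $\mathcal X$-valued, $(\mathcal F_t)$-adapted, c\`adl\`ag process; the $P^x$ are probability measures on $(\Omega,\mathcal F)$ with $(X_0)_*P^x=\delta_x$; $x\mapsto P^x(F)$ is universally measurable for every $F\in\mathcal F$; and $P^x(X_{t+s}\in B\mid\mathcal F_s)=p_t(X_s,B)$ $P^x$-a.s. for all $x$, all $s,t\ge 0$ and all Borel sets $B$. Write $E^x$ for the expectation under $P^x$. Let $\mu^*$ be a probability measure on $\mathcal X$ that is invariant for $p_t$, i.e. $\int p_t(x,\cdot)\,\mu^*(dx)=\mu^*$ for all $t\ge 0$. Let $L^2(\mu^*)$ be the complex $L^2$ space, and let $(A,D(A))$ be the generator of the semigroup $\mathcal P_t[g](x)=E^x[g(X_t)]$ on $L^2(\mu^*)$, i.e. $g\in D(A)$ with $A[g]=h$ iff $(\mathcal P_t[g]-g)/t\to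 h$ in $L^2(\mu^*)$ as $t\downarrow 0$; let $D(A,\mathbb R)$ be the set of real-valued functions in $D(A)$. Let $\beta>0$ and suppose that the log-Sobolev inequality with constant $\beta$ holds: $$\int g^2\log(g^2)\,d\mu^*\le-\beta\int A[g]\,g\,d\mu^*\qquad\text{for all } g\in D(A,\mathbb R)\text{ with }\|g\|_{L^2(\mu^*)}=1$$ (in particular the left-hand side is finite). Let $V\in L^1(\mu^*)$ be real-valued with $\int e^{\beta V}d\mu^*<\infty$. Then for every $t\ge 0$, $$\mathcal P^V_t[g](x)=E^x\left[g(X_t)\exp\left(\int_0^tV(X_s)\,ds\right)\right]$$ is a well-defined linear operator $\mathcal P_t^V:L^2(\mu^*)\to L^2(\mu^*)$. That is, for every $g\in L^2(\mu^*)$ and for $\mu^*$-almost every $x$, the time integral exists $P^x$-a.s. and the expectation is that of an integrable function; the result lies in $L^2(\mu^*)$, depends linearly on $g$, and up to $\mu^*$-null sets does not depend on the choice of representatives of $g$ and $V$. Moreover, its operator norm satisfies $$\|\mathcal P^V_t\|\le\left(\int e^{\beta V}d\mu^*\right)^{t/\beta}.$$ -/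

import Mathlib

open MeasureTheory ProbabilityTheory Filter Topology
open scoped NNReal ENNReal

/-- A time-homogeneous càdlàg Markov family `(Ω, ℱ, ℱ_t, X_t, P^x)` with state space `𝓧` and
transition probability kernels `p_t`. Universal measurability of `x ↦ P^x(F)` means
measurability with respect to the completion of every Borel probability measure on `𝓧`. -/
structure IsCadlagMarkovFamily {𝓧 Ω : Type*} [TopologicalSpace 𝓧] [MeasurableSpace 𝓧]
    {mΩ : MeasurableSpace Ω} (ℱ : Filtration ℝ≥0 mΩ) (X : ℝ≥0 → Ω → 𝓧)
    (P : 𝓧 → Measure Ω) (p : ℝ≥0 → Kernel 𝓧 𝓧) : Prop where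
  isMarkovKernel : ∀ t, IsMarkovKernel (p t)
  isProbabilityMeasure : ∀ x, IsProbabilityMeasure (P x)
  adapted : ∀ t, Measurable[ℱ t] (X t)
  right_continuous : ∀ ω t, ContinuousWithinAt (fun s => X s ω) (Set.Ici t) t
  left_limits : ∀ ω t, ∃ l, Tendsto (fun s => X s ω) (𝓝[<] t) (𝓝 l)
  initial : ∀ x, (P x).map (X 0) = Measure.dirac x
  universally_measurable : ∀ F : Set Ω, MeasurableSet F →
    ∀ ν : Measure 𝓧, IsProbabilityMeasure ν → AEMeasurable (fun x => P x F) ν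
  markov : ∀ (x : 𝓧) (s t : ℝ≥0) (B : Set 𝓧), MeasurableSet B →
    (P x)[(X (t + s) ⁻¹' B).indicator (fun _ => (1 : ℝ)) | ℱ s]
      =ᵐ[P x] fun ω => (p t (X s ω)).real B

/-- The Feynman–Kac integrand `g(X_t) exp(∫₀ᵗ V(X_s) ds)`. -/
noncomputable def feynmanKacIntegrand {𝓧 Ω : Type*} (X : ℝ≥0 → Ω → 𝓧)
    (V : 𝓧 → ℝ) (t : ℝ≥0) (g : 𝓧 → ℂ) (ω : Ω) : ℂ :=
  g (X t ω) * (Real.exp (∫ s in (0 : ℝ)..t, V (X s.toNNReal ω)) : ℂ)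

/-- `𝓟_t^V[g](x) = E^x[g(X_t) exp(∫₀ᵗ V(X_s) ds)]`. -/
noncomputable def feynmanKac {𝓧 Ω : Type*} [MeasurableSpace Ω] (X : ℝ≥0 → Ω → 𝓧)
    (P : 𝓧 → Measure Ω) (V : 𝓧 → ℝ) (t : ℝ≥0) (g : 𝓧 → ℂ) (x : 𝓧) : ℂ :=
  ∫ ω, feynmanKacIntegrand X V t g ω ∂(P x)

/-- `g ∈ D(A)` and `A[g] = h` (as elements of complex `L²(μ)`), where `A` is the generator of the
semigroup `𝓟_t = 𝓟_t^0` on `L²(μ)`: `(𝓟_t[g] - g) / t → h` in `L²(μ)` as `t ↓ 0`. -/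
def HasGenerator {𝓧 Ω : Type*} [MeasurableSpace 𝓧] [MeasurableSpace Ω] (X : ℝ≥0 → Ω → 𝓧)
    (P : 𝓧 → Measure Ω) (μ : Measure 𝓧) (g h : 𝓧 → ℂ) : Prop :=
  MemLp g 2 μ ∧ MemLp h 2 μ ∧
    Tendsto (fun t : ℝ≥0 =>
      eLpNorm (fun x => (feynmanKac X P 0 t g x - g x) / ((t : ℝ) : ℂ) - h x) 2 μ)
      (𝓝[>] 0) (𝓝 0)

/-- The log-Sobolev inequality with constant `β`: for all real-valued `g ∈ D(A)` with
`‖g‖_{L²(μ)} = 1`, `∫ g² log(g²) dμ ≤ -β ∫ A[g] g dμ`. Since `g² log(g²)` is bounded below, its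
integral lies in `(-∞, ∞]`, and the inequality includes that this integral is finite. -/
def LogSobolevInequality {𝓧 Ω : Type*} [MeasurableSpace 𝓧] [MeasurableSpace Ω]
    (X : ℝ≥0 → Ω → 𝓧) (P : 𝓧 → Measure Ω) (μ : Measure 𝓧) (β : ℝ) : Prop :=
  ∀ g h : 𝓧 → ℝ,
    HasGenerator X P μ (fun x => (g x : ℂ)) (fun x => (h x : ℂ)) → eLpNorm g 2 μ = 1 →
      Integrable (fun x => g x ^ 2 * Real.log (g x ^ 2)) μ ∧
        ∫ x, g x ^ 2 * Real.log (g x ^ 2) ∂μ ≤ -β * ∫ x, h x * g x ∂μ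

/-! Suppose first that V is bounded and continuous. Then S_t = P_t^V is a strongly continuous
semigroup on real L²(μ), and every f in the domain of its generator lies in D(A), with generator
value Af + Vf. For ‖f‖ = 1 the log-Sobolev inequality gives β⟨(A+V)f, f⟩ ≤ ∫ f²·βV dμ - ∫ f² log f²
dμ, and the Gibbs variational inequality bounds the right side by log ∫ e^{βV} dμ. So the quadratic
form of the generator is at most L = (1/β) log ∫ e^{βV} dμ on unit vectors. Grönwall's inequality
for ‖S_t f‖² and density of the domain give ‖S_t‖ ≤ e^{Lt} = (∫ e^{βV} dμ)^{t/β}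
(`IsStrongSemigroup.norm_le`, `hasGenerator_sub`, `inner_generator_le`).

For general V, choose bounded continuous W_n → V in L¹(μ), summably fast, with exponential moments
asymptotically no larger than that of V. Under the stationary path law the expected occupation
measure of [0,t] is tμ, so the time integrals of W_n converge almost surely to that of V. Fatou's
lemma, under P^x and then under μ, carries the estimate over (`lintegral_sq_le_of_integrable`).

The estimate passed to the limit is one for [0,∞]-valued test functions. Since |E^x[g(X_t)Z]| ≤
E^x[|g(X_t)|Z] for Z ≥ 0, it yields integrability, independence of representatives and the complex
operator norm with the same constant.

Two technical points shape the proof. The maps x ↦ P^x(F) are only universally measurable, so path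
measures are integrated set by set instead of through a kernel. The Markov property is given at one
future time only, so it is extended to the exponential functional by Riemann sums, using
right-continuity of paths. -/

/-! ### Strongly continuous semigroups: growth from the quadratic form of the generator. -/

section Semigroup

variable {H : Type*} [NormedAddCommGroup H] [InnerProductSpace ℝ H]

/-- A strongly continuous semigroup of operators `S t` with `‖S t‖ ≤ exp (C t)`. -/
structure IsStrongSemigroup (S : ℝ≥0 → H →L[ℝ] H) (C : ℝ) : Prop where
  zero : ∀ f, S 0 f = f
  add : ∀ s t f, S (s + t) f = S s (S t f)
  bound : ∀ t f, ‖S t f‖ ≤ Real.exp (C * t) * ‖f‖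
  cont : ∀ f, Tendsto (fun t => S t f) (𝓝[>] 0) (𝓝 f)

variable {S : ℝ≥0 → H →L[ℝ] H} {C : ℝ}

theorem IsStrongSemigroup.tendsto_zero (hS : IsStrongSemigroup S C) (f : H) :
    Tendsto (fun t => S t f) (𝓝 0) (𝓝 f) := by
  have h : ContinuousWithinAt (fun t => S t f) (Set.Ioi 0) 0 := by
    simpa [ContinuousWithinAt, hS.zero] using hS.cont f
  rw [continuousWithinAt_Ioi_iff_Ici] at h
  have e : Set.Ici (0 : ℝ≥0) = Set.univ := by ext; simp
  simpa [ContinuousWithinAt, e, hS.zero] using h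

theorem IsStrongSemigroup.continuous (hS : IsStrongSemigroup S C) (f : H) :
    Continuous fun t => S t f := by
  rw [continuous_iff_continuousAt]
  intro t
  -- The increment is S at the earlier time applied to S (max - min) f - f. Since C may be negative,
  -- |C| makes the bound monotone in time.
  have key : ∀ a b : ℝ≥0, dist (S a f) (S b f) ≤
      Real.exp (|C| * max a b) * ‖S (max a b - min a b) f - f‖ := by
    have main : ∀ a b : ℝ≥0, a ≤ b → dist (S b f) (S a f) ≤
      Real.exp (|C| * b) * ‖S (b - a) f - f‖ := by
      intro a b hab
      have : S b f = S a (S (b - a) f) := by rw [← hS.add, add_tsub_cancel_of_le hab]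
      rw [this, dist_eq_norm, ← map_sub]
      refine (hS.bound _ _).trans ?_
      gcongr
      exact le_abs_self C
    intro a b
    rcases le_total a b with h | h
    · rw [dist_comm]; simpa [h] using main a b h
    · simpa [h] using main b a h
  rw [ContinuousAt, tendsto_iff_dist_tendsto_zero]
  refine squeeze_zero (fun _ => dist_nonneg) (fun s => key s t) ?_
  have h1 : Tendsto (fun s : ℝ≥0 => Real.exp (|C| * max s t)) (𝓝 t)
      (𝓝 (Real.exp (|C| * max t t))) := by
    have : Continuous (fun s : ℝ≥0 => Real.exp (|C| * max s t)) := by fun_prop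
    simpa using this.tendsto t
  have h2 : Tendsto (fun s : ℝ≥0 => max s t - min s t) (𝓝 t) (𝓝 0) := by
    have : Continuous (fun s : ℝ≥0 => max s t - min s t) := by fun_prop
    simpa using this.tendsto t
  have h3 := ((hS.tendsto_zero f).comp h2).sub_const f |>.norm
  simpa using h1.mul h3

/-- If `f` is in the domain of the generator, then so is `S t f`. -/
theorem IsStrongSemigroup.generator_apply (hS : IsStrongSemigroup S C) {f h : H}
    (hf : Tendsto (fun r : ℝ≥0 => (r : ℝ)⁻¹ • (S r f - f)) (𝓝[>] 0) (𝓝 h)) (t : ℝ≥0) :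
    Tendsto (fun r : ℝ≥0 => (r : ℝ)⁻¹ • (S r (S t f) - S t f)) (𝓝[>] 0) (𝓝 (S t h)) := by
  have := ((S t).continuous.tendsto h).comp hf
  refine this.congr fun r => ?_
  simp only [Function.comp, map_smul, map_sub]
  rw [← hS.add, ← hS.add, add_comm]

theorem IsStrongSemigroup.hasDerivWithinAt (hS : IsStrongSemigroup S C) {f h : H}
    (hf : Tendsto (fun r : ℝ≥0 => (r : ℝ)⁻¹ • (S r f - f)) (𝓝[>] 0) (𝓝 h)) {x : ℝ} (hx : 0 ≤ x) :
    HasDerivWithinAt (fun r : ℝ => S r.toNNReal f) (S x.toNNReal h) (Set.Ici x) x := by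
  rw [← hasDerivWithinAt_Ioi_iff_Ici, hasDerivWithinAt_iff_tendsto_slope' (by simp)]
  have h1 : Tendsto (fun z : ℝ => (z - x).toNNReal) (𝓝[>] x) (𝓝[>] 0) := by
    refine tendsto_nhdsWithin_iff.2 ⟨?_, ?_⟩
    · have : Continuous fun z : ℝ => (z - x).toNNReal := by fun_prop
      simpa using (this.tendsto x).mono_left nhdsWithin_le_nhds
    · filter_upwards [self_mem_nhdsWithin] with z hz
      simpa using hz
  refine ((hS.generator_apply hf x.toNNReal).comp h1).congr' ?_
  filter_upwards [self_mem_nhdsWithin] with z hz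
  have hz' : x < z := hz
  have e : (z - x).toNNReal + x.toNNReal = z.toNNReal := by
    rw [← Real.toNNReal_add (by linarith) hx]; simp
  simp only [Function.comp, slope, vsub_eq_sub]
  rw [← hS.add, e, Real.coe_toNNReal _ (by linarith)]

/-- Growth bound on the domain of the generator. -/
theorem IsStrongSemigroup.norm_le_of_domain (hS : IsStrongSemigroup S C) {L : ℝ}
    (hL : ∀ f h : H, Tendsto (fun r : ℝ≥0 => (r : ℝ)⁻¹ • (S r f - f)) (𝓝[>] 0) (𝓝 h) →
      ‖f‖ = 1 → inner ℝ h f ≤ L) {f h : H}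
    (hf : Tendsto (fun r : ℝ≥0 => (r : ℝ)⁻¹ • (S r f - f)) (𝓝[>] 0) (𝓝 h)) (t : ℝ≥0) :
    ‖S t f‖ ≤ Real.exp (L * t) * ‖f‖ := by
  -- The bound on unit vectors extends by homogeneity, which also covers f = 0.
  have hL' : ∀ f h : H, Tendsto (fun r : ℝ≥0 => (r : ℝ)⁻¹ • (S r f - f)) (𝓝[>] 0) (𝓝 h) →
      inner ℝ h f ≤ L * ‖f‖ ^ 2 := by
    intro f h hfh
    rcases eq_or_ne f 0 with rfl | hne
    · simp
    have hn : ‖f‖ ≠ 0 := norm_ne_zero_iff.2 hne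
    have := hL (‖f‖⁻¹ • f) (‖f‖⁻¹ • h) ?_ ?_
    · rw [inner_smul_left, inner_smul_right] at this
      simp only [conj_trivial] at this
      have h2 : inner ℝ h f = ‖f‖ ^ 2 * (‖f‖⁻¹ * (‖f‖⁻¹ * inner ℝ h f)) := by field_simp
      rw [h2, mul_comm L]
      gcongr
    · refine (hfh.const_smul ‖f‖⁻¹).congr fun r => ?_
      rw [map_smul, ← smul_sub, smul_comm]
    · rw [norm_smul, norm_inv, norm_norm, inv_mul_cancel₀ hn]
  have hu : Continuous fun r : ℝ => S r.toNNReal f :=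
    (hS.continuous f).comp continuous_real_toNNReal
  have hd : ∀ x : ℝ, 0 ≤ x → HasDerivWithinAt (fun r : ℝ => ‖S r.toNNReal f‖ ^ 2)
      (2 * inner ℝ (S x.toNNReal f) (S x.toNNReal h)) (Set.Ici x) x := fun x hx =>
    (hS.hasDerivWithinAt hf hx).norm_sq
  -- Grönwall for ‖S_r f‖², whose right derivative 2⟨S_r f, S_r h⟩ is at most 2L‖S_r f‖². One-sided
  -- derivatives suffice, and L may have either sign.
  have := le_gronwallBound_of_liminf_deriv_right_le (f := fun r : ℝ => ‖S r.toNNReal f‖ ^ 2)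
    (f' := fun x => 2 * inner ℝ (S x.toNNReal f) (S x.toNNReal h)) (δ := ‖f‖ ^ 2)
    (K := 2 * L) (ε := 0) (a := 0) (b := t) (hu.norm.pow 2).continuousOn
    (fun x hx r hr => ?_) (by simp [hS.zero]) (fun x hx => ?_) t ⟨t.2, le_rfl⟩
  · rw [gronwallBound_ε0] at this
    simp only [Real.toNNReal_coe, sub_zero] at this
    refine le_of_sq_le_sq ?_ (by positivity)
    refine this.trans_eq ?_
    rw [mul_pow, ← Real.exp_nat_mul]; push_cast; ring_nf
  · exact ((hd x hx.1).liminf_right_slope_le hr).mono fun z hz => by simpa [slope] using hz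
  · have := hL' _ _ (hS.generator_apply hf x.toNNReal)
    rw [real_inner_comm] at this
    linarith

/-- The domain of the generator is dense: the averages ε⁻¹ ∫₀^ε S_s f ds lie in it and converge to
f, and the bound on the domain survives the limit. -/
theorem IsStrongSemigroup.norm_le [CompleteSpace H] (hS : IsStrongSemigroup S C) {L : ℝ}
    (hL : ∀ f h : H, Tendsto (fun r : ℝ≥0 => (r : ℝ)⁻¹ • (S r f - f)) (𝓝[>] 0) (𝓝 h) →
      ‖f‖ = 1 → inner ℝ h f ≤ L) (f : H) (t : ℝ≥0) :
    ‖S t f‖ ≤ Real.exp (L * t) * ‖f‖ := by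
  have hu : Continuous fun r : ℝ => S r.toNNReal f :=
    (hS.continuous f).comp continuous_real_toNNReal
  set F : ℝ → H := fun x => ∫ s in (0 : ℝ)..x, S s.toNNReal f with hF
  have hFd : ∀ x, HasDerivAt F (S x.toNNReal f) x := fun x =>
    intervalIntegral.integral_hasDerivAt_right (hu.intervalIntegrable _ _)
      (hu.stronglyMeasurableAtFilter _ _) hu.continuousAt
  -- averages over `[0, ε]` are in the domain
  have hdom : ∀ ε : ℝ, 0 < ε → Tendsto (fun r : ℝ≥0 => (r : ℝ)⁻¹ • (S r (F ε) - F ε)) (𝓝[>] 0)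
      (𝓝 (S ε.toNNReal f - f)) := by
    intro ε hε
    -- Since S_r commutes with the integral, S_r (F ε) = F (ε + r) - F r, so the generator quotient
    -- is a difference quotient of this function at 0.
    have h1 : HasDerivAt (fun r => F (ε + r) - F r) (S ε.toNNReal f - f) 0 := by
      have a := (hFd (ε + 0)).comp_const_add ε 0
      have b := hFd 0
      have c := a.sub b
      simp only [add_zero, Real.toNNReal_zero, hS.zero] at c
      exact c
    have h2 := h1.tendsto_slope_zero_right
    have h3 : Tendsto (fun r : ℝ≥0 => (r : ℝ)) (𝓝[>] 0) (𝓝[>] 0) := by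
      refine tendsto_nhdsWithin_iff.2 ⟨?_, ?_⟩
      · simpa using (NNReal.continuous_coe.tendsto 0).mono_left nhdsWithin_le_nhds
      · filter_upwards [self_mem_nhdsWithin] with z hz
        simpa using hz
    refine (h2.comp h3).congr fun r => ?_
    have e : S r (F ε) = F (ε + r) - F r := by
      have i := fun a b => hu.intervalIntegrable (μ := volume) a b
      simp only [hF]
      rw [← ContinuousLinearMap.intervalIntegral_comp_comm _ (i _ _),
        intervalIntegral.integral_interval_sub_left (i _ _) (i _ _)]
      have : ∫ x in (0 : ℝ)..ε, S r (S x.toNNReal f) = ∫ x in (0 : ℝ)..ε, S (x + r).toNNReal f := by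
        refine intervalIntegral.integral_congr fun x hx => ?_
        rw [Set.uIcc_of_le hε.le] at hx
        rw [← hS.add, Real.toNNReal_add hx.1 r.coe_nonneg, Real.toNNReal_coe, add_comm]
      rw [this, intervalIntegral.integral_comp_add_right (fun x => S x.toNNReal f), zero_add]
    have e0 : F 0 = 0 := by simp [hF]
    simp only [Function.comp, zero_add, add_zero, e, e0, sub_zero]
  have hbd : ∀ ε : ℝ, 0 < ε → ‖S t (ε⁻¹ • F ε)‖ ≤ Real.exp (L * t) * ‖ε⁻¹ • F ε‖ := by
    intro ε hε
    have := hS.norm_le_of_domain hL (hdom ε hε) t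
    rw [map_smul, norm_smul, norm_smul]
    calc _ ≤ ‖ε⁻¹‖ * (Real.exp (L * t) * ‖F ε‖) := by gcongr
      _ = _ := by ring
  have hlim : Tendsto (fun ε : ℝ => ε⁻¹ • F ε) (𝓝[>] 0) (𝓝 f) := by
    have := (hFd 0).tendsto_slope_zero_right
    have e0 : F 0 = 0 := by simp [hF]
    simpa [hS.zero, e0] using this
  refine le_of_tendsto_of_tendsto (((S t).continuous.tendsto f).comp hlim).norm
    (hlim.norm.const_mul _) ?_
  filter_upwards [self_mem_nhdsWithin] with ε hε using hbd ε hε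

end Semigroup

/-! ### Mixtures of universally measurable families and weighted expectation operators. -/

section Mixture

variable {𝓧 Ω : Type*} [MeasurableSpace 𝓧] {mΩ : MeasurableSpace Ω}
  {P : 𝓧 → Measure Ω} {μ : Measure 𝓧}

/-- The mixture `∫ P x μ(dx)` of a family of measures which is only almost everywhere measurable
set by set. -/
noncomputable def mixture (P : 𝓧 → Measure Ω) (μ : Measure 𝓧)
    (hP : ∀ F, MeasurableSet F → AEMeasurable (fun x => P x F) μ) : Measure Ω :=
  Measure.ofMeasurable (fun F _ => ∫⁻ x, P x F ∂μ) (by simp) (by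
    intro f hf hd
    rw [← lintegral_tsum fun i => hP _ (hf i)]
    exact lintegral_congr fun x => measure_iUnion hd hf)

variable (hP : ∀ F, MeasurableSet F → AEMeasurable (fun x => P x F) μ)
include hP

theorem mixture_apply {F : Set Ω} (hF : MeasurableSet F) :
    mixture P μ hP F = ∫⁻ x, P x F ∂μ :=
  Measure.ofMeasurable_apply F hF

theorem mixture_isProbabilityMeasure [IsProbabilityMeasure μ] (h1 : ∀ x, IsProbabilityMeasure (P x)) :
    IsProbabilityMeasure (mixture P μ hP) :=
  ⟨by simp [mixture_apply hP MeasurableSet.univ]⟩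

/-- Both claims go through one induction, because the additive and monotone steps of the integral
identity need measurability of the inner integrals. -/
theorem aemeasurable_lintegral_and_lintegral_mixture {F : Ω → ℝ≥0∞} (hF : Measurable F) :
    AEMeasurable (fun x => ∫⁻ ω, F ω ∂P x) μ ∧
      ∫⁻ ω, F ω ∂mixture P μ hP = ∫⁻ x, ∫⁻ ω, F ω ∂P x ∂μ := by
  refine hF.ennreal_induction (motive := fun F => AEMeasurable (fun x => ∫⁻ ω, F ω ∂P x) μ ∧
      ∫⁻ ω, F ω ∂mixture P μ hP = ∫⁻ x, ∫⁻ ω, F ω ∂P x ∂μ) ?_ ?_ ?_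
  · intro c s hs
    simp only [lintegral_indicator_const hs]
    refine ⟨(hP s hs).const_mul c, ?_⟩
    rw [mixture_apply hP hs, lintegral_const_mul'' _ (hP s hs)]
  · intro f g hd hf hg hf' hg'
    simp only [Pi.add_apply]
    simp only [lintegral_add_left hf]
    refine ⟨hf'.1.add hg'.1, ?_⟩
    rw [hf'.2, hg'.2, lintegral_add_left' hf'.1]
  · intro f hf hm ih
    simp only [lintegral_iSup hf hm]
    refine ⟨.iSup fun n => (ih n).1, ?_⟩
    simp only [(ih _).2]
    rw [lintegral_iSup' (fun n => (ih n).1)]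
    exact ae_of_all _ fun x m n hmn => lintegral_mono (hm hmn)

theorem aemeasurable_lintegral_of_measurable {F : Ω → ℝ≥0∞} (hF : Measurable F) :
    AEMeasurable (fun x => ∫⁻ ω, F ω ∂P x) μ :=
  (aemeasurable_lintegral_and_lintegral_mixture hP hF).1

theorem lintegral_mixture_of_measurable {F : Ω → ℝ≥0∞} (hF : Measurable F) :
    ∫⁻ ω, F ω ∂mixture P μ hP = ∫⁻ x, ∫⁻ ω, F ω ∂P x ∂μ :=
  (aemeasurable_lintegral_and_lintegral_mixture hP hF).2

/-- A measurable hull N of the exceptional set satisfies ∫ P x N dμ = 0. This turns almost sure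
statements under the mixture into statements for μ-almost every starting point. -/
theorem ae_ae_of_ae_mixture {p : Ω → Prop} (h : ∀ᵐ ω ∂mixture P μ hP, p ω) :
    ∀ᵐ x ∂μ, ∀ᵐ ω ∂P x, p ω := by
  set N := toMeasurable (mixture P μ hP) {ω | ¬ p ω}
  have hN : MeasurableSet N := measurableSet_toMeasurable _ _
  have h0 : ∫⁻ x, P x N ∂μ = 0 := by
    rw [← mixture_apply hP hN, measure_toMeasurable]; exact h
  rw [lintegral_eq_zero_iff' (hP N hN)] at h0
  filter_upwards [h0] with x hx
  exact measure_mono_null (subset_toMeasurable _ _) hx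

theorem aemeasurable_lintegral_of_aemeasurable {F : Ω → ℝ≥0∞} (hF : AEMeasurable F (mixture P μ hP)) :
    AEMeasurable (fun x => ∫⁻ ω, F ω ∂P x) μ := by
  refine (aemeasurable_lintegral_of_measurable hP hF.measurable_mk).congr ?_
  filter_upwards [ae_ae_of_ae_mixture hP hF.ae_eq_mk] with x hx
  exact lintegral_congr_ae (hx.mono fun _ h => h.symm)

theorem lintegral_mixture {F : Ω → ℝ≥0∞} (hF : AEMeasurable F (mixture P μ hP)) :
    ∫⁻ ω, F ω ∂mixture P μ hP = ∫⁻ x, ∫⁻ ω, F ω ∂P x ∂μ := by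
  rw [lintegral_congr_ae hF.ae_eq_mk, lintegral_mixture_of_measurable hP hF.measurable_mk]
  refine lintegral_congr_ae ?_
  filter_upwards [ae_ae_of_ae_mixture hP hF.ae_eq_mk] with x hx
  exact lintegral_congr_ae (hx.mono fun _ h => h.symm)

theorem ae_aestronglyMeasurable_of_mixture {E : Type*} [TopologicalSpace E]
    {G : Ω → E} (hG : AEStronglyMeasurable G (mixture P μ hP)) :
    ∀ᵐ x ∂μ, AEStronglyMeasurable G (P x) := by
  filter_upwards [ae_ae_of_ae_mixture hP hG.ae_eq_mk] with x hx
  exact ⟨_, hG.stronglyMeasurable_mk, hx⟩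

theorem ae_integrable_of_mixture {E : Type*} [NormedAddCommGroup E]
    {G : Ω → E} (hG : Integrable G (mixture P μ hP)) : ∀ᵐ x ∂μ, Integrable G (P x) := by
  have h := hG.2
  rw [HasFiniteIntegral, lintegral_mixture hP hG.1.enorm] at h
  filter_upwards [ae_aestronglyMeasurable_of_mixture hP hG.1,
    ae_lt_top' (aemeasurable_lintegral_of_aemeasurable hP hG.1.enorm) h.ne] with x h1 h2
  exact ⟨h1, h2⟩

theorem aemeasurable_integral_real {G : Ω → ℝ} (hG : Integrable G (mixture P μ hP)) :
    AEMeasurable (fun x => ∫ ω, G ω ∂P x) μ := by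
  refine AEMeasurable.congr (f := fun x => (∫⁻ ω, .ofReal (G ω) ∂P x).toReal -
    (∫⁻ ω, .ofReal (-G ω) ∂P x).toReal) ?_ ?_
  · exact (aemeasurable_lintegral_of_aemeasurable hP hG.1.aemeasurable.ennreal_ofReal).ennreal_toReal.sub
      (aemeasurable_lintegral_of_aemeasurable hP hG.1.aemeasurable.neg.ennreal_ofReal).ennreal_toReal
  · filter_upwards [ae_integrable_of_mixture hP hG] with x hx
    rw [integral_eq_lintegral_pos_part_sub_lintegral_neg_part hx]

theorem aestronglyMeasurable_integral {𝕜 : Type*} [RCLike 𝕜] {G : Ω → 𝕜}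
    (hG : Integrable G (mixture P μ hP)) :
    AEStronglyMeasurable (fun x => ∫ ω, G ω ∂P x) μ := by
  have h1 := (aemeasurable_integral_real hP hG.re).aestronglyMeasurable
  have h2 := (aemeasurable_integral_real hP hG.im).aestronglyMeasurable
  refine AEStronglyMeasurable.congr (f := fun x => ((∫ ω, RCLike.re (G ω) ∂P x : ℝ) : 𝕜) +
    (∫ ω, RCLike.im (G ω) ∂P x : ℝ) * RCLike.I) ?_ ?_
  · exact (RCLike.continuous_ofReal.comp_aestronglyMeasurable h1).add
      ((RCLike.continuous_ofReal.comp_aestronglyMeasurable h2).mul_const _)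
  · filter_upwards [ae_integrable_of_mixture hP hG] with x hx
    exact integral_re_add_im hx

omit hP in
theorem eLpNorm_two_sq {α E : Type*} [MeasurableSpace α] [NormedAddCommGroup E] (f : α → E)
    (ν : Measure α) : eLpNorm f 2 ν ^ 2 = ∫⁻ x, ‖f x‖ₑ ^ 2 ∂ν := by
  simpa using eLpNorm_nnreal_pow_eq_lintegral (f := f) (μ := ν) (p := 2) (by norm_num)

omit hP in
theorem sq_lintegral_le_lintegral_sq {α : Type*} [MeasurableSpace α] {ν : Measure α}
    [IsProbabilityMeasure ν] {f : α → ℝ≥0∞} (hf : AEMeasurable f ν) :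
    (∫⁻ x, f x ∂ν) ^ 2 ≤ ∫⁻ x, f x ^ 2 ∂ν := by
  have := ENNReal.lintegral_mul_le_Lp_mul_Lq ν Real.HolderConjugate.two_two hf
    (aemeasurable_const (b := 1))
  simp only [Pi.mul_apply, mul_one, ENNReal.one_rpow, lintegral_const, measure_univ] at this
  calc _ ≤ ((∫⁻ x, f x ^ (2 : ℝ) ∂ν) ^ (1 / 2 : ℝ)) ^ 2 := by gcongr
    _ = _ := by
      rw [← ENNReal.rpow_natCast, ← ENNReal.rpow_mul]; norm_num

/-- Averaging over each probability measure P x contracts L², by Cauchy–Schwarz against the constant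
1. -/
theorem eLpNorm_integral_le {𝕜 : Type*} [RCLike 𝕜] (h1 : ∀ x, IsProbabilityMeasure (P x))
    {G : Ω → 𝕜} (hG : AEStronglyMeasurable G (mixture P μ hP)) :
    eLpNorm (fun x => ∫ ω, G ω ∂P x) 2 μ ≤ eLpNorm G 2 (mixture P μ hP) := by
  rw [← ENNReal.pow_le_pow_left_iff (n := 2) (by norm_num), eLpNorm_two_sq, eLpNorm_two_sq,
    lintegral_mixture hP (hG.enorm.pow_const 2)]
  refine lintegral_mono_ae ?_
  filter_upwards [ae_aestronglyMeasurable_of_mixture hP hG] with x hx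
  exact (pow_le_pow_left' (enorm_integral_le_lintegral_enorm _) 2).trans
    (sq_lintegral_le_lintegral_sq hx.enorm)

variable {Y : Ω → 𝓧} (hY : Measurable Y) {W : Ω → ℝ} (hW : Measurable W)
  (hW0 : ∀ ω, 0 ≤ W ω) {c : ℝ} (hc : 0 ≤ c)
  (hb : ∀ φ : 𝓧 → ℝ≥0∞, Measurable φ →
    ∫⁻ x, (∫⁻ ω, φ (Y ω) * .ofReal (W ω) ∂P x) ^ 2 ∂μ ≤ .ofReal c ^ 2 * ∫⁻ x, φ x ^ 2 ∂μ)
include hY hW hb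

/-- The estimate `hb` applied to the indicator of N has right side 0. This gives independence of
representatives with no assumption on the law of Y. -/
theorem ae_weighted_eq_zero {N : Set 𝓧} (hN : MeasurableSet N) (h0 : μ N = 0) :
    ∀ᵐ ω ∂mixture P μ hP, Y ω ∈ N → ENNReal.ofReal (W ω) = 0 := by
  have h := hb (N.indicator 1) (measurable_one.indicator hN)
  have e : ∫⁻ x, N.indicator (1 : 𝓧 → ℝ≥0∞) x ^ 2 ∂μ = 0 := by
    have : ∀ x, N.indicator (1 : 𝓧 → ℝ≥0∞) x ^ 2 = N.indicator (1 : 𝓧 → ℝ≥0∞) x := by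
      intro x; by_cases hx : x ∈ N <;> simp [hx]
    simp only [this]
    rw [lintegral_indicator_one hN, h0]
  have hm : Measurable fun ω => N.indicator (1 : 𝓧 → ℝ≥0∞) (Y ω) * .ofReal (W ω) :=
    ((measurable_one.indicator hN).comp hY).mul hW.ennreal_ofReal
  rw [e, mul_zero, nonpos_iff_eq_zero, lintegral_eq_zero_iff'
    ((aemeasurable_lintegral_of_measurable hP hm).pow_const 2)] at h
  have h2 : ∫⁻ ω, N.indicator (1 : 𝓧 → ℝ≥0∞) (Y ω) * .ofReal (W ω) ∂mixture P μ hP = 0 := by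
    rw [lintegral_mixture_of_measurable hP hm, lintegral_eq_zero_iff'
      (aemeasurable_lintegral_of_measurable hP hm)]
    filter_upwards [h] with x hx
    simpa using hx
  rw [lintegral_eq_zero_iff hm] at h2
  filter_upwards [h2] with ω hω hN'
  simpa [hN'] using hω

include hW0

theorem ae_weighted_congr {𝕜 : Type*} [RCLike 𝕜] {f g : 𝓧 → 𝕜} (hfg : f =ᵐ[μ] g) :
    (fun ω => f (Y ω) * (W ω : 𝕜)) =ᵐ[mixture P μ hP] fun ω => g (Y ω) * (W ω : 𝕜) := by
  have hN := measurableSet_toMeasurable μ {x | f x ≠ g x}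
  have h0 : μ (toMeasurable μ {x | f x ≠ g x}) = 0 := by
    rw [measure_toMeasurable]; exact hfg
  filter_upwards [ae_weighted_eq_zero hP hY hW hb hN h0] with ω hω
  by_cases h : f (Y ω) = g (Y ω)
  · simp [h]
  · have : W ω = 0 :=
      le_antisymm (ENNReal.ofReal_eq_zero.1 (hω (subset_toMeasurable _ _ h))) (hW0 ω)
    simp [this]

theorem integrable_weighted [IsProbabilityMeasure μ] {𝕜 : Type*} [RCLike 𝕜] {f : 𝓧 → 𝕜} (hf : MemLp f 2 μ) :
    Integrable (fun ω => f (Y ω) * (W ω : 𝕜)) (mixture P μ hP) := by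
  refine Integrable.congr ?_ (ae_weighted_congr hP hY hW hW0 hb hf.1.ae_eq_mk).symm
  have hmk := hf.1.stronglyMeasurable_mk
  have hsm : StronglyMeasurable fun ω => (hf.1.mk f) (Y ω) * (W ω : 𝕜) :=
    (hmk.comp_measurable hY).mul (RCLike.continuous_ofReal.comp_stronglyMeasurable hW.stronglyMeasurable)
  refine ⟨hsm.aestronglyMeasurable, ?_⟩
  rw [HasFiniteIntegral, lintegral_mixture_of_measurable hP hsm.measurable.enorm]
  have e : ∀ ω, ‖(hf.1.mk f) (Y ω) * (W ω : 𝕜)‖ₑ = ‖(hf.1.mk f) (Y ω)‖ₑ * .ofReal (W ω) := by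
    intro ω
    rw [enorm_mul, ← ofReal_norm (W ω : 𝕜), RCLike.norm_ofReal, abs_of_nonneg (hW0 ω)]
  -- Only |f| enters: the square of the mean over μ is at most the mean square, which `hb` makes
  -- finite.
  have h2 := hb (fun x => ‖(hf.1.mk f) x‖ₑ) hmk.measurable.enorm
  rw [← eLpNorm_two_sq] at h2
  have h3 := sq_lintegral_le_lintegral_sq (aemeasurable_lintegral_of_measurable hP hsm.measurable.enorm)
  simp only [e] at h3 ⊢
  have h4 : ENNReal.ofReal c ^ 2 * eLpNorm (hf.1.mk f) 2 μ ^ 2 < ∞ :=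
    ENNReal.mul_lt_top (by simp) (by simpa using (hf.ae_eq hf.1.ae_eq_mk).2)
  have := (h3.trans h2).trans_lt h4
  by_contra hne
  rw [not_lt, top_le_iff] at hne
  simp [hne] at this

theorem eLpNorm_weighted_le {𝕜 : Type*} [RCLike 𝕜] {f : 𝓧 → 𝕜} (hf : MemLp f 2 μ) :
    eLpNorm (fun x => ∫ ω, f (Y ω) * (W ω : 𝕜) ∂P x) 2 μ ≤ .ofReal c * eLpNorm f 2 μ := by
  have hc' := ae_ae_of_ae_mixture hP (ae_weighted_congr hP hY hW hW0 hb hf.1.ae_eq_mk)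
  rw [← ENNReal.pow_le_pow_left_iff (n := 2) (by norm_num), mul_pow,
    eLpNorm_congr_ae hf.1.ae_eq_mk, eLpNorm_two_sq, eLpNorm_two_sq]
  refine le_trans (lintegral_mono_ae ?_) (hb _ hf.1.stronglyMeasurable_mk.measurable.enorm)
  filter_upwards [hc'] with x hx
  rw [integral_congr_ae hx]
  gcongr
  refine (enorm_integral_le_lintegral_enorm _).trans_eq ?_
  congr with ω
  rw [enorm_mul, ← ofReal_norm (W ω : 𝕜), RCLike.norm_ofReal, abs_of_nonneg (hW0 ω)]

/-- The operator `f ↦ (x ↦ ∫ f(Y) W dP_x)` on `L²(μ)`. -/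
theorem exists_weighted_operator [IsProbabilityMeasure μ] {𝕜 : Type*} [RCLike 𝕜] (hc : 0 ≤ c) :
    ∃ T : Lp 𝕜 2 μ →L[𝕜] Lp 𝕜 2 μ, ‖T‖ ≤ c ∧ ∀ (f : 𝓧 → 𝕜) (hf : MemLp f 2 μ),
      T (hf.toLp f) =ᵐ[μ] fun x => ∫ ω, f (Y ω) * (W ω : 𝕜) ∂P x := by
  have hmem : ∀ {f : 𝓧 → 𝕜}, MemLp f 2 μ →
      MemLp (fun x => ∫ ω, f (Y ω) * (W ω : 𝕜) ∂P x) 2 μ := fun {f} hf =>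
    ⟨aestronglyMeasurable_integral hP (integrable_weighted hP hY hW hW0 hb hf),
      (eLpNorm_weighted_le hP hY hW hW0 hb hf).trans_lt (ENNReal.mul_lt_top (by simp) hf.2)⟩
  have hcongr : ∀ {f g : 𝓧 → 𝕜}, f =ᵐ[μ] g → (fun x => ∫ ω, f (Y ω) * (W ω : 𝕜) ∂P x) =ᵐ[μ]
      fun x => ∫ ω, g (Y ω) * (W ω : 𝕜) ∂P x := fun {f g} hfg => by
    filter_upwards [ae_ae_of_ae_mixture hP (ae_weighted_congr hP hY hW hW0 hb hfg)] with x hx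
    exact integral_congr_ae hx
  let T₀ : Lp 𝕜 2 μ →ₗ[𝕜] Lp 𝕜 2 μ :=
    { toFun := fun f => (hmem (Lp.memLp f)).toLp _
      map_add' := fun f g => by
        rw [← MemLp.toLp_add, MemLp.toLp_eq_toLp_iff]
        refine (hcongr (Lp.coeFn_add f g)).trans ?_
        filter_upwards [ae_integrable_of_mixture hP
          (integrable_weighted hP hY hW hW0 hb (Lp.memLp f)), ae_integrable_of_mixture hP
          (integrable_weighted hP hY hW hW0 hb (Lp.memLp g))] with x h1 h2
        simp only [Pi.add_apply, add_mul]
        exact integral_add h1 h2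
      map_smul' := fun a f => by
        rw [RingHom.id_apply, ← MemLp.toLp_const_smul, MemLp.toLp_eq_toLp_iff]
        refine (hcongr (Lp.coeFn_smul a f)).trans (ae_of_all _ fun x => ?_)
        simp only [Pi.smul_apply, smul_eq_mul, mul_assoc]
        exact integral_const_mul _ _ }
  have hT : ∀ f : Lp 𝕜 2 μ, ‖T₀ f‖ ≤ c * ‖f‖ := fun f => by
    have h := eLpNorm_weighted_le hP hY hW hW0 hb (Lp.memLp f)
    change ‖(hmem (Lp.memLp f)).toLp _‖ ≤ _
    rw [Lp.norm_toLp, Lp.norm_def]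
    have := ENNReal.toReal_mono (ENNReal.mul_ne_top (by simp) (Lp.eLpNorm_ne_top f)) h
    rwa [ENNReal.toReal_mul, ENNReal.toReal_ofReal hc] at this
  refine ⟨T₀.mkContinuous c hT, T₀.mkContinuous_norm_le hc hT, fun f hf => ?_⟩
  exact (MemLp.coeFn_toLp (hmem (Lp.memLp (hf.toLp f)))).trans (hcongr hf.coeFn_toLp)

end Mixture

/-! ### Riemann sums of bounded right-continuous functions. -/

section Riemann

/-- Rounding up to a grid of vanishing mesh converges from the right. -/
theorem tendsto_ceil_mul {τ : ℕ → ℝ} (hτ : ∀ᶠ n in atTop, 0 < τ n) (h0 : Tendsto τ atTop (𝓝 0))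
    {r : ℝ} (hr : 0 ≤ r) :
    Tendsto (fun n => (⌈r / τ n⌉₊ : ℝ) * τ n) atTop (𝓝[≥] r) := by
  refine tendsto_nhdsWithin_iff.2 ⟨?_, ?_⟩
  · have h1 : Tendsto (fun n => r + τ n) atTop (𝓝 r) := by simpa using h0.const_add r
    refine tendsto_of_tendsto_of_tendsto_of_le_of_le' tendsto_const_nhds h1 ?_ ?_
    · filter_upwards [hτ] with n hn
      rw [← div_le_iff₀ hn]
      exact Nat.le_ceil _
    · filter_upwards [hτ] with n hn
      have := (Nat.ceil_lt_add_one (div_nonneg hr hn.le)).le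
      calc _ ≤ (r / τ n + 1) * τ n := by gcongr
        _ = _ := by field_simp
  · filter_upwards [hτ] with n hn
    rw [Set.mem_Ici, ← div_le_iff₀ hn]
    exact Nat.le_ceil _

/-- The right-endpoint sum is exactly the integral of v at times rounded up to the grid. Rounding up
approaches each time from the right, so right-continuity and dominated convergence suffice. -/
theorem tendsto_riemann_sum {v : ℝ → ℝ} (hv : Measurable v) {C : ℝ} (hC : ∀ r, |v r| ≤ C)
    (hc : ∀ r, ContinuousWithinAt v (Set.Ici r) r) {t : ℝ} (ht : 0 ≤ t) :
    Tendsto (fun n : ℕ => ∑ k ∈ Finset.range n, t / n * v ((k + 1 : ℕ) * (t / n))) atTop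
      (𝓝 (∫ r in (0 : ℝ)..t, v r)) := by
  rcases ht.eq_or_lt with rfl | ht
  · simp
  set τ : ℕ → ℝ := fun n => t / n with hτdef
  have hτ : ∀ᶠ n in atTop, 0 < τ n := by
    filter_upwards [eventually_gt_atTop 0] with n hn
    positivity
  have h0 : Tendsto τ atTop (𝓝 0) := tendsto_const_div_atTop_nhds_zero_nat t
  have hm : ∀ n, Measurable fun r => v ((⌈r / τ n⌉₊ : ℝ) * τ n) := fun n =>
    hv.comp (((measurable_from_top (f := fun k : ℕ => (k : ℝ))).comp
      (Nat.measurable_ceil.comp (measurable_id.div_const _))).mul_const _)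
  have hint : ∀ n a b, IntervalIntegrable (fun r => v ((⌈r / τ n⌉₊ : ℝ) * τ n)) volume a b := by
    intro n a b
    refine (intervalIntegrable_const (c := C)).mono_fun (hm n).aestronglyMeasurable ?_
    exact ae_of_all _ fun r => by
      simpa using (hC _).trans (le_abs_self C)
  have hlim : Tendsto (fun n => ∫ r in (0 : ℝ)..t, v ((⌈r / τ n⌉₊ : ℝ) * τ n)) atTop
      (𝓝 (∫ r in (0 : ℝ)..t, v r)) := by
    refine intervalIntegral.tendsto_integral_filter_of_dominated_convergence (fun _ => C)
      (.of_forall fun n => (hm n).aestronglyMeasurable)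
      (.of_forall fun n => ae_of_all _ fun r _ => hC _) intervalIntegrable_const
      (ae_of_all _ fun r hr => ?_)
    rw [Set.uIoc_of_le ht.le] at hr
    exact (hc r).tendsto.comp (tendsto_ceil_mul hτ h0 hr.1.le)
  refine hlim.congr' ?_
  filter_upwards [eventually_gt_atTop 0] with n hn
  have hn' : (0 : ℝ) < n := by exact_mod_cast hn
  have hpos : 0 < τ n := by positivity
  have hsum := intervalIntegral.sum_integral_adjacent_intervals (a := fun k : ℕ => (k : ℝ) * τ n)
    (n := n) (f := fun r => v ((⌈r / τ n⌉₊ : ℝ) * τ n)) (μ := volume) fun k _ => hint n _ _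
  have hnt : (n : ℝ) * τ n = t := by simp only [hτdef]; field_simp
  simp only [Nat.cast_zero, zero_mul, hnt] at hsum
  rw [← hsum]
  refine Finset.sum_congr rfl fun k _ => ?_
  have : ∫ r in ((k : ℝ) * τ n)..((k + 1 : ℕ) * τ n), v ((⌈r / τ n⌉₊ : ℝ) * τ n) =
      ∫ r in ((k : ℝ) * τ n)..((k + 1 : ℕ) * τ n), v ((k + 1 : ℕ) * τ n) := by
    refine intervalIntegral.integral_congr_ae (ae_of_all _ fun r hr => ?_)
    rw [Set.uIoc_of_le (by push_cast; nlinarith)] at hr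
    have : ⌈r / τ n⌉₊ = k + 1 := by
      rw [Nat.ceil_eq_iff (by omega)]
      exact ⟨by simpa [lt_div_iff₀ hpos] using hr.1, by simpa [div_le_iff₀ hpos] using hr.2⟩
    rw [this]
  rw [this, intervalIntegral.integral_const, smul_eq_mul]
  push_cast
  ring

end Riemann

/-! ### Path measurability and the Markov property along time grids. -/

section Markov

variable {𝓧 Ω : Type*} [TopologicalSpace 𝓧] [PolishSpace 𝓧] [MeasurableSpace 𝓧]
    [BorelSpace 𝓧] {mΩ : MeasurableSpace Ω} {ℱ : Filtration ℝ≥0 mΩ} {X : ℝ≥0 → Ω → 𝓧}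
    {P : 𝓧 → Measure Ω} {p : ℝ≥0 → Kernel 𝓧 𝓧}

namespace IsCadlagMarkovFamily

variable (hX : IsCadlagMarkovFamily ℱ X P p)
include hX

omit [PolishSpace 𝓧] [BorelSpace 𝓧] in
theorem measurable (t : ℝ≥0) : Measurable (X t) := (hX.adapted t).mono (ℱ.le t) le_rfl

omit [PolishSpace 𝓧] [BorelSpace 𝓧] in
theorem continuousWithinAt_toNNReal (ω : Ω) (r : ℝ) :
    ContinuousWithinAt (fun r : ℝ => X r.toNNReal ω) (Set.Ici r) r :=
  (hX.right_continuous ω r.toNNReal).comp (t := Set.Ici r.toNNReal)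
    continuous_real_toNNReal.continuousWithinAt fun _ hz => Real.toNNReal_mono hz

/-- By right-continuity, X is the pointwise limit of X evaluated at times rounded up to the grid of
mesh 1/(n+1), which takes countably many time values. -/
theorem measurable_uncurry : Measurable fun q : ℝ × Ω => X q.1.toNNReal q.2 := by
  have h0 : Tendsto (fun n : ℕ => ((n : ℝ) + 1)⁻¹) atTop (𝓝 0) := by
    simpa using tendsto_one_div_add_atTop_nhds_zero_nat (𝕜 := ℝ)
  have hlim : ∀ q : ℝ × Ω, Tendsto (fun n : ℕ =>
      X ((⌈max q.1 0 / ((n : ℝ) + 1)⁻¹⌉₊ : ℝ) * ((n : ℝ) + 1)⁻¹).toNNReal q.2) atTop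
      (𝓝 (X q.1.toNNReal q.2)) := by
    intro q
    have := (hX.continuousWithinAt_toNNReal q.2 (max q.1 0)).tendsto.comp
      (tendsto_ceil_mul (.of_forall fun n => by positivity) h0 (le_max_right q.1 0))
    have e : (max q.1 0).toNNReal = q.1.toNNReal := by ext; simp
    rwa [e] at this
  refine measurable_of_tendsto_metrizable (fun n => ?_) (tendsto_pi_nhds.2 hlim)
  have h1 : Measurable fun q : ℕ × Ω => X ((q.1 : ℝ) * ((n : ℝ) + 1)⁻¹).toNNReal q.2 :=
    measurable_from_prod_countable_right fun k =>
      hX.measurable ((k : ℝ) * ((n : ℝ) + 1)⁻¹).toNNReal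
  have h2 : Measurable fun q : ℝ × Ω => (⌈max q.1 0 / ((n : ℝ) + 1)⁻¹⌉₊, q.2) :=
    (Nat.measurable_ceil.comp ((measurable_fst.max measurable_const).div_const _)).prodMk
      measurable_snd
  exact h1.comp h2

theorem measurable_path (ω : Ω) : Measurable fun r : ℝ => X r.toNNReal ω :=
  hX.measurable_uncurry.comp (measurable_id.prodMk measurable_const)

omit [PolishSpace 𝓧] [BorelSpace 𝓧] in
theorem lintegral_initial (x : 𝓧) {ψ : 𝓧 → ℝ≥0∞} (hψ : Measurable ψ) :
    ∫⁻ ω, ψ (X 0 ω) ∂P x = ψ x := by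
  rw [← lintegral_map hψ (hX.measurable 0), hX.initial, lintegral_dirac' _ hψ]

omit [PolishSpace 𝓧] [BorelSpace 𝓧] in
theorem setLIntegral_markov (x : 𝓧) (s t : ℝ≥0) {B : Set 𝓧} (hB : MeasurableSet B) {F : Set Ω}
    (hF : MeasurableSet[ℱ s] F) :
    ∫⁻ ω in F, p t (X s ω) B ∂P x = P x (F ∩ X (t + s) ⁻¹' B) := by
  have := hX.isMarkovKernel t
  have := hX.isProbabilityMeasure x
  have hpre : MeasurableSet (X (t + s) ⁻¹' B) := hX.measurable _ hB
  have h := setIntegral_condExp (ℱ.le s) (f := (X (t + s) ⁻¹' B).indicator (fun _ => (1 : ℝ)))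
    ((integrable_const 1).indicator hpre) (μ := P x) hF
  rw [setIntegral_congr_ae (ℱ.le s _ hF) ((hX.markov x s t B hB).mono fun ω h _ => h),
    integral_indicator_const _ hpre, smul_eq_mul, mul_one] at h
  have hm : Measurable fun ω => (p t (X s ω)).real B :=
    ((Kernel.measurable_coe (p t) hB).comp (hX.measurable s)).ennreal_toReal
  have hi : Integrable (fun ω => (p t (X s ω)).real B) ((P x).restrict F) :=
    Integrable.of_bound hm.aestronglyMeasurable 1 (ae_of_all _ fun ω => by
      rw [Real.norm_of_nonneg measureReal_nonneg]
      exact measureReal_le_one)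
  have h2 := ofReal_integral_eq_lintegral_ofReal hi (ae_of_all _ fun ω => measureReal_nonneg)
  rw [h] at h2
  simp only [ofReal_measureReal (measure_ne_top _ _)] at h2
  rw [← h2, Measure.restrict_apply hpre, Set.inter_comm]

omit [PolishSpace 𝓧] [BorelSpace 𝓧] in
-- Monotone class argument in two stages: first in Z for indicator φ, starting from the conditional
-- expectation identity, then in φ.
theorem lintegral_markov (x : 𝓧) (s t : ℝ≥0) {Z : Ω → ℝ≥0∞} (hZ : Measurable[ℱ s] Z)
    {φ : 𝓧 → ℝ≥0∞} (hφ : Measurable φ) :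
    ∫⁻ ω, Z ω * φ (X (t + s) ω) ∂P x = ∫⁻ ω, Z ω * ∫⁻ y, φ y ∂p t (X s ω) ∂P x := by
  have hset : ∀ B, MeasurableSet B → ∀ Z : Ω → ℝ≥0∞, Measurable[ℱ s] Z →
      ∫⁻ ω, Z ω * B.indicator 1 (X (t + s) ω) ∂P x = ∫⁻ ω, Z ω * p t (X s ω) B ∂P x := by
    intro B hB Z hZ
    have hb1 : Measurable fun ω => B.indicator (1 : 𝓧 → ℝ≥0∞) (X (t + s) ω) :=
      (measurable_one.indicator hB).comp (hX.measurable _)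
    have hb2 : Measurable fun ω => p t (X s ω) B :=
      (Kernel.measurable_coe (p t) hB).comp (hX.measurable s)
    refine @Measurable.ennreal_induction Ω (ℱ s) (fun Z =>
      ∫⁻ ω, Z ω * B.indicator 1 (X (t + s) ω) ∂P x = ∫⁻ ω, Z ω * p t (X s ω) B ∂P x)
      ?_ ?_ ?_ Z hZ
    · intro c F hF
      have e : ∀ g : Ω → ℝ≥0∞, Measurable g →
          ∫⁻ ω, F.indicator (fun _ => c) ω * g ω ∂P x = c * ∫⁻ ω in F, g ω ∂P x := by
        intro g hg
        rw [← lintegral_const_mul _ hg, ← lintegral_indicator (ℱ.le s _ hF)]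
        congr with ω
        by_cases h : ω ∈ F <;> simp [h]
      rw [e _ hb1, e _ hb2, hX.setLIntegral_markov x s t hB hF]
      have : (fun ω => B.indicator (1 : 𝓧 → ℝ≥0∞) (X (t + s) ω)) = (X (t + s) ⁻¹' B).indicator 1 := rfl
      rw [this, lintegral_indicator_one (hX.measurable _ hB),
        Measure.restrict_apply (hX.measurable _ hB), Set.inter_comm]
    · intro f g _ hf hg h1 h2
      simp only [Pi.add_apply, add_mul]
      have hf' := hf.mono (ℱ.le s) le_rfl
      rw [lintegral_add_left (f := fun ω => f ω * _) (hf'.mul hb1),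
        lintegral_add_left (f := fun ω => f ω * _) (hf'.mul hb2), h1, h2]
    · intro f hf hm ih
      have e : ∀ g : Ω → ℝ≥0∞, Measurable g →
          ∫⁻ ω, (⨆ n, f n ω) * g ω ∂P x = ⨆ n, ∫⁻ ω, f n ω * g ω ∂P x := by
        intro g hg
        simp only [ENNReal.iSup_mul]
        exact lintegral_iSup (fun n => ((hf n).mono (ℱ.le s) le_rfl).mul hg)
          fun m n hmn ω => mul_le_mul_left (hm hmn ω) _
      rw [e _ hb1, e _ hb2]
      simp only [ih]
  have hZ' := hZ.mono (ℱ.le s) le_rfl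
  refine hφ.ennreal_induction (motive := fun φ =>
    ∫⁻ ω, Z ω * φ (X (t + s) ω) ∂P x = ∫⁻ ω, Z ω * ∫⁻ y, φ y ∂p t (X s ω) ∂P x) ?_ ?_ ?_
  · intro c B hB
    have e : ∀ y, B.indicator (fun _ => c) y = c * B.indicator 1 y := fun y => by
      by_cases h : y ∈ B <;> simp [h]
    simp only [lintegral_indicator_const hB]
    simp only [e, mul_left_comm _ c]
    rw [lintegral_const_mul, lintegral_const_mul, hset B hB Z hZ]
    · exact hZ'.mul ((Kernel.measurable_coe (p t) hB).comp (hX.measurable s))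
    · exact hZ'.mul ((measurable_one.indicator hB).comp (hX.measurable _))
  · intro f g _ hf hg h1 h2
    simp only [Pi.add_apply, lintegral_add_left hf, mul_add]
    rw [lintegral_add_left (f := fun ω => Z ω * f _) (hZ'.mul (hf.comp (hX.measurable _))),
      lintegral_add_left (f := fun ω => Z ω * ∫⁻ y, f y ∂_)
        (hZ'.mul (hf.lintegral_kernel.comp (hX.measurable _))), h1, h2]
  · intro f hf hm ih
    simp only [lintegral_iSup hf hm, ENNReal.mul_iSup]
    rw [lintegral_iSup, lintegral_iSup]
    · simp only [ih]
    · exact fun n => hZ'.mul ((hf n).lintegral_kernel.comp (hX.measurable _))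
    · exact fun m n hmn ω => mul_le_mul_right (lintegral_mono (hm hmn)) _
    · exact fun n => hZ'.mul ((hf n).comp (hX.measurable _))
    · exact fun m n hmn ω => mul_le_mul_right (hm hmn _) _

omit [PolishSpace 𝓧] [BorelSpace 𝓧] in
theorem lintegral_apply (x : 𝓧) (t : ℝ≥0) {φ : 𝓧 → ℝ≥0∞} (hφ : Measurable φ) :
    ∫⁻ ω, φ (X t ω) ∂P x = ∫⁻ y, φ y ∂p t x := by
  have := hX.lintegral_markov x 0 t (Z := 1) measurable_const hφ
  simp only [add_zero, Pi.one_apply, one_mul] at this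
  rw [this, hX.lintegral_initial x hφ.lintegral_kernel]

omit [PolishSpace 𝓧] [BorelSpace 𝓧] in
/-- Iterated Markov property along a grid of times. -/
theorem lintegral_prod_grid (x : 𝓧) {w : 𝓧 → ℝ≥0∞} (hw : Measurable w) (τ : ℝ≥0)
    {φ : 𝓧 → ℝ≥0∞} (hφ : Measurable φ) (n : ℕ) (s : ℝ≥0) {Z : Ω → ℝ≥0∞}
    (hZ : Measurable[ℱ s] Z) :
    ∫⁻ ω, Z ω * ((∏ k ∈ Finset.range n, w (X (s + (k + 1 : ℕ) * τ) ω)) * φ (X (s + n * τ) ω)) ∂P x =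
      ∫⁻ ω, Z ω * ((fun (ψ : 𝓧 → ℝ≥0∞) y => ∫⁻ z, w z * ψ z ∂p τ y)^[n] φ) (X s ω) ∂P x := by
  have hm : ∀ n, Measurable ((fun (ψ : 𝓧 → ℝ≥0∞) y => ∫⁻ z, w z * ψ z ∂p τ y)^[n] φ) := by
    intro n
    induction n with
    | zero => simpa using hφ
    | succ n ih =>
      rw [Function.iterate_succ_apply']
      exact (hw.mul ih).lintegral_kernel
  induction n generalizing s Z with
  | zero => simp
  | succ n ih =>
    have hle : s ≤ s + τ := le_self_add
    -- The weight at the first grid point joins the past factor Z, and the induction hypothesis is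
    -- used from time s + τ; hence the generalization over s and Z.
    have hZ2 : Measurable[ℱ (s + τ)] fun ω => Z ω * w (X (s + τ) ω) :=
      (hZ.mono (ℱ.mono hle) le_rfl).mul (hw.comp (hX.adapted _))
    have h := ih (s + τ) hZ2
    rw [Function.iterate_succ_apply']
    have h2 := hX.lintegral_markov x s τ hZ (hw.mul (hm n))
    simp only [Pi.mul_apply] at h2
    rw [← h2, add_comm τ s]
    simp only [mul_assoc] at h
    rw [← h]
    refine lintegral_congr fun ω => ?_
    rw [Finset.prod_range_succ']
    have e : ∀ k : ℕ, s + ((k + 1 : ℕ) : ℝ≥0) * τ = s + τ + k * τ := fun k => by push_cast; ring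
    simp only [e, Nat.cast_zero, zero_mul, add_zero]
    ring

end IsCadlagMarkovFamily

end Markov

/-! ### The exponential functional of a bounded continuous potential. -/

section BoundedPotential

variable {𝓧 Ω : Type*} [TopologicalSpace 𝓧] [PolishSpace 𝓧] [MeasurableSpace 𝓧]
    [BorelSpace 𝓧] {mΩ : MeasurableSpace Ω} {ℱ : Filtration ℝ≥0 mΩ} {X : ℝ≥0 → Ω → 𝓧}
    {P : 𝓧 → Measure Ω} {p : ℝ≥0 → Kernel 𝓧 𝓧}

/-- The multiplicative functional `exp(∫₀ᵗ V(X_s) ds)`. -/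
noncomputable def expFunctional {𝓧 Ω : Type*} (X : ℝ≥0 → Ω → 𝓧) (V : 𝓧 → ℝ) (t : ℝ≥0) (ω : Ω) : ℝ :=
  Real.exp (∫ s in (0 : ℝ)..t, V (X s.toNNReal ω))

omit [TopologicalSpace 𝓧] [PolishSpace 𝓧] [MeasurableSpace 𝓧] [BorelSpace 𝓧] in
theorem expFunctional_zero (V : 𝓧 → ℝ) (ω : Ω) : expFunctional X V 0 ω = 1 := by
  simp [expFunctional]

namespace IsCadlagMarkovFamily

variable (hX : IsCadlagMarkovFamily ℱ X P p)
include hX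

theorem measurable_timeIntegral {V : 𝓧 → ℝ} (hV : Measurable V) (t : ℝ≥0) :
    Measurable fun ω => ∫ s in (0 : ℝ)..t, V (X s.toNNReal ω) := by
  have h : Measurable fun q : ℝ × Ω => V (X q.1.toNNReal q.2) := hV.comp hX.measurable_uncurry
  simp only [intervalIntegral.integral_of_le t.coe_nonneg]
  exact (h.stronglyMeasurable.integral_prod_left' (μ := volume.restrict (Set.Ioc 0 (t : ℝ)))).measurable

theorem measurable_expFunctional {V : 𝓧 → ℝ} (hV : Measurable V) (t : ℝ≥0) :
    Measurable (expFunctional X V t) :=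
  Real.measurable_exp.comp (hX.measurable_timeIntegral hV t)

variable {V : 𝓧 → ℝ} (hV : Continuous V) {C : ℝ} (hC : ∀ x, |V x| ≤ C)

omit hX [PolishSpace 𝓧] [TopologicalSpace 𝓧] [MeasurableSpace 𝓧] [BorelSpace 𝓧] mΩ in
include hC in
theorem abs_timeIntegral_le (t : ℝ≥0) (ω : Ω) :
    |∫ s in (0 : ℝ)..t, V (X s.toNNReal ω)| ≤ C * t := by
  simpa using intervalIntegral.norm_integral_le_of_norm_le_const (a := 0) (b := (t : ℝ))
    (f := fun s : ℝ => V (X s.toNNReal ω)) fun s _ => hC _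

omit hX [PolishSpace 𝓧] [TopologicalSpace 𝓧] [MeasurableSpace 𝓧] [BorelSpace 𝓧] mΩ in
include hC in
theorem expFunctional_le (t : ℝ≥0) (ω : Ω) : expFunctional X V t ω ≤ Real.exp (C * t) :=
  Real.exp_le_exp.2 ((le_abs_self _).trans (abs_timeIntegral_le hC t ω))

include hV hC

theorem tendsto_riemann (s t : ℝ≥0) (ω : Ω) :
    Tendsto (fun n : ℕ => ∑ k ∈ Finset.range n,
      ((t / n : ℝ≥0) : ℝ) * V (X (s + (k + 1 : ℕ) * (t / n : ℝ≥0)) ω))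
      atTop (𝓝 (∫ r in (0 : ℝ)..t, V (X (s + r.toNNReal) ω))) := by
  have hm : Measurable fun r : ℝ => V (X (s + r.toNNReal) ω) := by
    have := (hV.measurable.comp (hX.measurable_path ω)).comp
      (measurable_real_toNNReal.const_add s).coe_nnreal_real
    simpa only [Function.comp_def, Real.toNNReal_coe] using this
  have hc : ∀ r, ContinuousWithinAt (fun r : ℝ => V (X (s + r.toNNReal) ω)) (Set.Ici r) r := by
    intro r
    refine hV.continuousAt.comp_continuousWithinAt ?_
    exact ContinuousWithinAt.comp (f := fun r : ℝ => s + r.toNNReal)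
      (hX.right_continuous ω (s + r.toNNReal)) (t := Set.Ici (s + r.toNNReal))
      (continuous_real_toNNReal.const_add s).continuousWithinAt
      fun z hz => add_le_add_right (Real.toNNReal_mono hz) s
  have h := tendsto_riemann_sum hm (fun r => hC _) hc t.coe_nonneg
  refine h.congr fun n => Finset.sum_congr rfl fun k _ => ?_
  have e : (((k + 1 : ℕ) : ℝ) * ((t : ℝ) / n)).toNNReal = (k + 1 : ℕ) * (t / n : ℝ≥0) := by
    rw [← Real.toNNReal_coe (r := (k + 1 : ℕ) * (t / n : ℝ≥0))]
    push_cast; rfl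
  rw [e]
  push_cast
  rfl

/-- Joint measurability of the process would only give measurability for the full σ-algebra. The
Riemann sums over [0,t] use times at most t, so their limit is ℱ t-measurable. -/
theorem adapted_timeIntegral (t : ℝ≥0) :
    Measurable[ℱ t] fun ω => ∫ s in (0 : ℝ)..t, V (X s.toNNReal ω) := by
  have h := fun ω => hX.tendsto_riemann hV hC 0 t ω
  simp only [zero_add] at h
  refine @measurable_of_tendsto_metrizable Ω ℝ (ℱ t) _ _ _ _ _ _ (fun n => ?_) (tendsto_pi_nhds.2 h)
  refine Finset.measurable_fun_sum _ fun k hk => ?_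
  refine (hV.measurable.comp ((hX.adapted _).mono (ℱ.mono ?_) le_rfl)).const_mul _
  have hk : k + 1 ≤ n := Finset.mem_range.1 hk
  have hn : (0 : ℝ≥0) < n := by
    have : 0 < n := by omega
    exact_mod_cast this
  calc ((k + 1 : ℕ) : ℝ≥0) * (t / n) ≤ n * (t / n) := by gcongr
    _ = t := by field_simp

theorem intervalIntegrable_path (ω : Ω) (a b : ℝ) :
    IntervalIntegrable (fun s : ℝ => V (X s.toNNReal ω)) volume a b := by
  refine (intervalIntegrable_const (c := C)).mono_fun
    (hV.measurable.comp (hX.measurable_path ω)).aestronglyMeasurable ?_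
  exact ae_of_all _ fun r => by simpa using (hC _).trans (le_abs_self C)

theorem timeIntegral_add (s t : ℝ≥0) (ω : Ω) :
    ∫ r in (0 : ℝ)..(s + t : ℝ≥0), V (X r.toNNReal ω) =
      (∫ r in (0 : ℝ)..s, V (X r.toNNReal ω)) + ∫ r in (0 : ℝ)..t, V (X (s + r.toNNReal) ω) := by
  have hi := hX.intervalIntegrable_path hV hC ω
  rw [← intervalIntegral.integral_add_adjacent_intervals (hi 0 s) (hi s _)]
  congr 1
  have h := intervalIntegral.integral_comp_add_left (a := 0) (b := t)
    (fun r : ℝ => V (X r.toNNReal ω)) (s : ℝ)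
  rw [NNReal.coe_add, ← add_zero (s : ℝ), add_assoc, zero_add, ← h]
  refine intervalIntegral.integral_congr fun r hr => ?_
  rw [Set.uIcc_of_le t.coe_nonneg] at hr
  simp [Real.toNNReal_add s.coe_nonneg hr.1]

/-- The Markov property for the Feynman–Kac functional of a bounded continuous potential. -/
theorem lintegral_expFunctional_shift (x : 𝓧) (s t : ℝ≥0) {Z : Ω → ℝ≥0∞}
    (hZ : Measurable[ℱ s] Z) {M : ℝ≥0} (hM : ∀ ω, Z ω ≤ M) {φ : 𝓧 → ℝ≥0∞} (hφ : Measurable φ)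
    (h1 : ∀ x, φ x ≤ 1) :
    ∫⁻ ω, Z ω * (.ofReal (Real.exp (∫ r in (0 : ℝ)..t, V (X (s + r.toNNReal) ω))) *
      φ (X (s + t) ω)) ∂P x =
    ∫⁻ ω, Z ω * (∫⁻ ω', .ofReal (expFunctional X V t ω') * φ (X t ω') ∂P (X s ω)) ∂P x := by
  have hprob := hX.isProbabilityMeasure
  set w : ℕ → 𝓧 → ℝ≥0∞ := fun n y => .ofReal (Real.exp ((t / n : ℝ≥0) * V y)) with hw
  have hwm : ∀ n, Measurable (w n) := fun n =>
    (Real.measurable_exp.comp (hV.measurable.const_mul _)).ennreal_ofReal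
  have hC0 : 0 ≤ C := (abs_nonneg _).trans (hC x)
  have hprod : ∀ (n : ℕ) (s : ℝ≥0) ω,
      ∏ k ∈ Finset.range n, w n (X (s + (k + 1 : ℕ) * (t / n : ℝ≥0)) ω) =
      .ofReal (Real.exp (∑ k ∈ Finset.range n,
        ((t / n : ℝ≥0) : ℝ) * V (X (s + (k + 1 : ℕ) * (t / n : ℝ≥0)) ω))) := by
    intro n s ω
    rw [Real.exp_sum, ENNReal.ofReal_prod_of_nonneg fun _ _ => (Real.exp_pos _).le]
  have hprod_le : ∀ (n : ℕ) (s : ℝ≥0) ω,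
      ∏ k ∈ Finset.range n, w n (X (s + (k + 1 : ℕ) * (t / n : ℝ≥0)) ω) ≤
        .ofReal (Real.exp (C * t)) := by
    intro n s ω
    rw [hprod]
    refine ENNReal.ofReal_le_ofReal (Real.exp_le_exp.2 ?_)
    calc _ ≤ ∑ k ∈ Finset.range n, ((t / n : ℝ≥0) : ℝ) * C := by
          gcongr with k _
          exact (le_abs_self _).trans (hC _)
      _ ≤ C * t := by
          rw [Finset.sum_const, Finset.card_range, nsmul_eq_mul]
          rcases eq_or_ne n 0 with rfl | hn
          · simpa using mul_nonneg hC0 t.coe_nonneg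
          · have : (n : ℝ) ≠ 0 := by exact_mod_cast hn
            push_cast
            apply le_of_eq; field_simp
  -- By the grid Markov property the discretized functional equals the n-th iterate of ψ ↦ ∫ w ψ
  -- dp_{t/n}, evaluated at X_s. The bounds on Z, V and φ permit dominated convergence.
  have hlim : ∀ (x : 𝓧) (s : ℝ≥0) (Z : Ω → ℝ≥0∞), Measurable[ℱ s] Z → ∀ M : ℝ≥0,
      (∀ ω, Z ω ≤ M) →
      Tendsto (fun n : ℕ => ∫⁻ ω, Z ω *
        ((fun (ψ : 𝓧 → ℝ≥0∞) y => ∫⁻ z, w n z * ψ z ∂p (t / n) y)^[n] φ) (X s ω) ∂P x) atTop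
        (𝓝 (∫⁻ ω, Z ω * (.ofReal (Real.exp (∫ r in (0 : ℝ)..t, V (X (s + r.toNNReal) ω))) *
          φ (X (s + t) ω)) ∂P x)) := by
    intro x s Z hZ M hM
    have hZ' := hZ.mono (ℱ.le s) le_rfl
    have hlim : Tendsto (fun n : ℕ => ∫⁻ ω, Z ω *
        ((∏ k ∈ Finset.range n, w n (X (s + (k + 1 : ℕ) * (t / n : ℝ≥0)) ω)) *
          φ (X (s + t) ω)) ∂P x) atTop
        (𝓝 (∫⁻ ω, Z ω * (.ofReal (Real.exp (∫ r in (0 : ℝ)..t, V (X (s + r.toNNReal) ω))) *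
          φ (X (s + t) ω)) ∂P x)) := by
      refine tendsto_lintegral_of_dominated_convergence
        (fun _ => M * (.ofReal (Real.exp (C * t)) * 1)) (fun n => ?_) (fun n => ae_of_all _ fun ω => ?_)
        ?_ (ae_of_all _ fun ω => ?_)
      · refine hZ'.mul (Measurable.mul ?_ (hφ.comp (hX.measurable _)))
        exact Finset.measurable_fun_prod _ fun k _ => (hwm n).comp (hX.measurable _)
      · exact mul_le_mul' (hM ω) (mul_le_mul' (hprod_le n s ω) (h1 _))
      · simp [ENNReal.mul_eq_top]
      · have hZt : Z ω ≠ ∞ := ((hM ω).trans_lt ENNReal.coe_lt_top).ne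
        have hφt : φ (X (s + t) ω) ≠ ∞ := ((h1 _).trans_lt ENNReal.one_lt_top).ne
        refine ENNReal.Tendsto.const_mul (ENNReal.Tendsto.mul_const ?_ (.inr hφt)) (.inr hZt)
        simp only [hprod]
        exact ENNReal.tendsto_ofReal ((Real.continuous_exp.tendsto _).comp
          (hX.tendsto_riemann hV hC s t ω))
    refine hlim.congr' ?_
    filter_upwards [eventually_gt_atTop 0] with n hn
    rw [← hX.lintegral_prod_grid x (hwm n) _ hφ n s hZ]
    have e : (n : ℝ≥0) * (t / n) = t := by
      have : (n : ℝ≥0) ≠ 0 := by exact_mod_cast hn.ne'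
      field_simp
    rw [e]
  have hQm : ∀ n m : ℕ, Measurable
      ((fun (ψ : 𝓧 → ℝ≥0∞) y => ∫⁻ z, w n z * ψ z ∂p (t / n) y)^[m] φ) := by
    intro n m
    induction m with
    | zero => simpa using hφ
    | succ m ih =>
      rw [Function.iterate_succ_apply']
      exact ((hwm n).mul ih).lintegral_kernel
  -- The case s = 0, Z = 1 identifies the pointwise limit of the iterates. Inserting it at y = X_s
  -- gives a second limit for the same sequence, and uniqueness of limits concludes.
  have hpt : ∀ y, Tendsto (fun n : ℕ =>
        ((fun (ψ : 𝓧 → ℝ≥0∞) y => ∫⁻ z, w n z * ψ z ∂p (t / n) y)^[n] φ) y) atTop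
        (𝓝 (∫⁻ ω', .ofReal (expFunctional X V t ω') * φ (X t ω') ∂P y)) := by
    intro y
    have := hlim y 0 1 measurable_const 1 (fun _ => by simp)
    simp only [Pi.one_apply, one_mul, zero_add] at this
    refine this.congr fun n => ?_
    rw [hX.lintegral_initial y (hQm n n)]
  refine tendsto_nhds_unique (hlim x s Z hZ M hM) ?_
  refine tendsto_lintegral_filter_of_dominated_convergence
    (fun _ => M * (.ofReal (Real.exp (C * t)) * 1)) (.of_forall fun n => ?_) ?_
    ?_ (ae_of_all _ fun ω => ?_)
  · exact (hZ.mono (ℱ.le s) le_rfl).mul ((hQm n n).comp (hX.measurable _))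
  · filter_upwards [eventually_gt_atTop 0] with n hn
    refine ae_of_all _ fun ω => mul_le_mul' (hM ω) ?_
    -- Read as an expectation started from X_s ω, the iterate is at most e^{Ct}.
    have h := hX.lintegral_prod_grid (X s ω) (hwm n) (t / n) hφ n 0 (Z := 1) measurable_const
    simp only [Pi.one_apply, one_mul] at h
    rw [hX.lintegral_initial _ (hQm n n)] at h
    rw [← h]
    calc _ ≤ ∫⁻ _, .ofReal (Real.exp (C * t)) * 1 ∂P (X s ω) :=
          lintegral_mono fun ω' => mul_le_mul' (hprod_le n 0 ω') (h1 _)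
      _ = _ := by simp
  · simp [ENNReal.mul_eq_top]
  · have hZt : Z ω ≠ ∞ := ((hM ω).trans_lt ENNReal.coe_lt_top).ne
    exact ENNReal.Tendsto.const_mul (hpt _) (.inr hZt)

theorem lintegral_expFunctional_add (x : 𝓧) (s t : ℝ≥0) {φ : 𝓧 → ℝ≥0∞} (hφ : Measurable φ)
    (h1 : ∀ x, φ x ≤ 1) :
    ∫⁻ ω, .ofReal (expFunctional X V (s + t) ω) * φ (X (s + t) ω) ∂P x =
    ∫⁻ ω, .ofReal (expFunctional X V s ω) *
      (∫⁻ ω', .ofReal (expFunctional X V t ω') * φ (X t ω') ∂P (X s ω)) ∂P x := by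
  have hZ : Measurable[ℱ s] fun ω => ENNReal.ofReal (expFunctional X V s ω) :=
    (Real.measurable_exp.comp (hX.adapted_timeIntegral hV hC s)).ennreal_ofReal
  rw [← hX.lintegral_expFunctional_shift hV hC x s t hZ (M := (Real.exp (C * s)).toNNReal)
    (fun ω => ENNReal.ofReal_le_ofReal (expFunctional_le hC s ω)) hφ h1]
  refine lintegral_congr fun ω => ?_
  rw [← mul_assoc, expFunctional, expFunctional, ← ENNReal.ofReal_mul (Real.exp_pos _).le,
    ← Real.exp_add, hX.timeIntegral_add hV hC]

end IsCadlagMarkovFamily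

end BoundedPotential

/-! ### Stationary path law and L² continuity at time 0. -/

section StrongContinuity

theorem tendsto_eLpNorm_two_zero_of_dominated {α ι E : Type*} [MeasurableSpace α] {ν : Measure α}
    [NormedAddCommGroup E] {l : Filter ι} [l.IsCountablyGenerated] {F : ι → α → E} {G : α → ℝ}
    (hF : ∀ᶠ i in l, AEStronglyMeasurable (F i) ν) (hG : MemLp G 2 ν)
    (hle : ∀ᶠ i in l, ∀ᵐ a ∂ν, ‖F i a‖ ≤ ‖G a‖)
    (hlim : ∀ᵐ a ∂ν, Tendsto (fun i => F i a) l (𝓝 0)) :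
    Tendsto (fun i => eLpNorm (F i) 2 ν) l (𝓝 0) := by
  have h1 : Tendsto (fun i => ∫⁻ a, ‖F i a‖ₑ ^ 2 ∂ν) l (𝓝 (∫⁻ _, 0 ∂ν)) := by
    refine tendsto_lintegral_filter_of_dominated_convergence' (fun a => ‖G a‖ₑ ^ 2) ?_ ?_ ?_ ?_
    · filter_upwards [hF] with i hi using hi.enorm.pow_const 2
    · filter_upwards [hle] with i hi
      filter_upwards [hi] with a ha
      gcongr
      exact enorm_le_iff_norm_le.2 ha
    · rw [← eLpNorm_two_sq]
      exact ENNReal.pow_ne_top hG.2.ne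
    · filter_upwards [hlim] with a ha
      have : Tendsto (fun i => ‖F i a‖ₑ) l (𝓝 0) := by simpa using ha.enorm
      simpa using ENNReal.Tendsto.pow (n := 2) this
  simp only [lintegral_zero, ← eLpNorm_two_sq] at h1
  have h2 := (ENNReal.continuous_rpow_const (y := (2 : ℝ)⁻¹)).tendsto 0 |>.comp h1
  refine (by simpa using h2 : Tendsto _ l (𝓝 (0 : ℝ≥0∞))).congr fun i => ?_
  rw [Function.comp, ← ENNReal.rpow_natCast, ← ENNReal.rpow_mul]
  norm_num

variable {𝓧 Ω : Type*} [TopologicalSpace 𝓧] [PolishSpace 𝓧] [MeasurableSpace 𝓧]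
    [BorelSpace 𝓧] {mΩ : MeasurableSpace Ω} {ℱ : Filtration ℝ≥0 mΩ} {X : ℝ≥0 → Ω → 𝓧}
    {P : 𝓧 → Measure Ω} {p : ℝ≥0 → Kernel 𝓧 𝓧}

namespace IsCadlagMarkovFamily

variable (hX : IsCadlagMarkovFamily ℱ X P p) (μ : Measure 𝓧) [IsProbabilityMeasure μ]

omit [PolishSpace 𝓧] [BorelSpace 𝓧] in
include hX in
theorem aemeasurable_apply (F : Set Ω) (hF : MeasurableSet F) : AEMeasurable (fun x => P x F) μ :=
  hX.universally_measurable F hF μ inferInstance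

/-- The law of the process started from the initial distribution `μ`. -/
noncomputable def pathMeasure : Measure Ω := mixture P μ (hX.aemeasurable_apply μ)

instance pathMeasure_isProbabilityMeasure : IsProbabilityMeasure (hX.pathMeasure μ) :=
  mixture_isProbabilityMeasure _ hX.isProbabilityMeasure

variable {μ}

omit [PolishSpace 𝓧] [BorelSpace 𝓧] in
theorem measurePreserving (hμ : ∀ t, (p t).Invariant μ) (t : ℝ≥0) :
    MeasurePreserving (X t) (hX.pathMeasure μ) μ := by
  refine ⟨hX.measurable t, ?_⟩
  ext B hB
  rw [Measure.map_apply (hX.measurable t) hB, pathMeasure, mixture_apply _ (hX.measurable t hB)]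
  conv_rhs => rw [← (hμ t).def, Measure.bind_apply hB (Kernel.aemeasurable _)]
  refine lintegral_congr fun x => ?_
  rw [← lintegral_indicator_one hB, ← hX.lintegral_apply x t (measurable_one.indicator hB)]
  exact (lintegral_indicator_one (hX.measurable t hB)).symm

/-- For bounded continuous g this is right-continuity plus dominated convergence. Stationarity makes
the error of replacing f by g the same at time t and at time 0, hence ε/4 + ε/2 + ε/4. -/
theorem tendsto_eLpNorm_comp_sub (hμ : ∀ t, (p t).Invariant μ) {f : 𝓧 → ℝ} (hf : MemLp f 2 μ) :
    Tendsto (fun t : ℝ≥0 => eLpNorm (fun ω => f (X t ω) - f (X 0 ω)) 2 (hX.pathMeasure μ))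
      (𝓝[>] 0) (𝓝 0) := by
  let := TopologicalSpace.upgradeIsCompletelyMetrizable 𝓧
  rw [ENNReal.tendsto_nhds_zero]
  intro ε hε
  have hε4 : ε / 4 ≠ 0 := by simp [hε.ne']
  obtain ⟨g, hg, hgm⟩ := hf.exists_boundedContinuous_eLpNorm_sub_le (by norm_num) hε4
  have hgt : Tendsto (fun t : ℝ≥0 => eLpNorm (fun ω => g (X t ω) - g (X 0 ω)) 2 (hX.pathMeasure μ))
      (𝓝[>] 0) (𝓝 0) := by
    refine tendsto_eLpNorm_two_zero_of_dominated (G := fun _ => 2 * ‖g‖) (.of_forall fun t => ?_)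
      (memLp_const _) (.of_forall fun t => ae_of_all _ fun ω => ?_) (ae_of_all _ fun ω => ?_)
    · exact ((g.continuous.measurable.comp (hX.measurable t)).sub
        (g.continuous.measurable.comp (hX.measurable 0))).aestronglyMeasurable
    · rw [Real.norm_of_nonneg (by positivity : 0 ≤ 2 * ‖g‖), ← dist_eq_norm]
      exact g.dist_le_two_norm _ _
    · have h1 : Tendsto (fun t => X t ω) (𝓝[>] 0) (𝓝 (X 0 ω)) :=
        (hX.right_continuous ω 0).mono_left (nhdsWithin_mono _ Set.Ioi_subset_Ici_self)
      simpa using ((g.continuous.tendsto _).comp h1).sub_const (g (X 0 ω))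
  filter_upwards [(ENNReal.tendsto_nhds_zero.1 hgt) (ε / 2) (by simp [hε.ne'])] with t ht
  have hmp := hX.measurePreserving hμ
  have hd : ∀ t, eLpNorm (fun ω => f (X t ω) - g (X t ω)) 2 (hX.pathMeasure μ) ≤ ε / 4 := by
    intro t
    have := eLpNorm_comp_measurePreserving (p := 2) (hf.1.sub hgm.1) (hmp t)
    exact this.trans_le hg
  have hfm : ∀ t, AEStronglyMeasurable (fun ω => f (X t ω)) (hX.pathMeasure μ) := fun t =>
    hf.1.comp_measurePreserving (hmp t)
  have hgm' : ∀ t, AEStronglyMeasurable (fun ω => g (X t ω)) (hX.pathMeasure μ) := fun t =>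
    hgm.1.comp_measurePreserving (hmp t)
  have e : (fun ω => f (X t ω) - f (X 0 ω)) = (fun ω => f (X t ω) - g (X t ω)) +
      ((fun ω => g (X t ω) - g (X 0 ω)) - fun ω => f (X 0 ω) - g (X 0 ω)) := by
    ext ω; simp
  rw [e]
  calc _ ≤ ε / 4 + (ε / 2 + ε / 4) := by
        refine (eLpNorm_add_le ((hfm t).sub (hgm' t)) (((hgm' t).sub (hgm' 0)).sub
          ((hfm 0).sub (hgm' 0))) (by norm_num)).trans (add_le_add (hd t) ?_)
        exact (eLpNorm_sub_le ((hgm' t).sub (hgm' 0)) ((hfm 0).sub (hgm' 0)) (by norm_num)).trans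
          (add_le_add ht (hd 0))
    _ = ε := by
        have : ε / 4 + ε / 4 = ε / 2 := by
          rw [ENNReal.div_add_div_same, ← two_mul, ENNReal.div_eq_inv_mul, ENNReal.div_eq_inv_mul,
            ← mul_assoc]
          congr 1
          rw [show (4 : ℝ≥0∞) = 2 * 2 by norm_num, ENNReal.mul_inv (by simp) (by simp), mul_assoc,
            ENNReal.inv_mul_cancel (by simp) (by simp), mul_one]
        rw [add_left_comm, this, ENNReal.add_halves]

/-- Split as (f(X_t) - f(X_0)) D_t + f(X_0) (D_t - D₀). Taking D_t as the exponential functional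
gives strong continuity; taking its difference quotient identifies the generator. -/
theorem tendsto_eLpNorm_comp_mul_sub (hμ : ∀ t, (p t).Invariant μ) {f : 𝓧 → ℝ} (hf : MemLp f 2 μ)
    {D : ℝ≥0 → Ω → ℝ} {D₀ : Ω → ℝ} (hD : ∀ t, Measurable (D t)) {K : ℝ} (hK : 0 ≤ K)
    (hle : ∀ᶠ t in 𝓝[>] 0, ∀ ω, |D t ω| ≤ K)
    (hlim : ∀ ω, Tendsto (fun t => D t ω) (𝓝[>] 0) (𝓝 (D₀ ω))) :
    Tendsto (fun t : ℝ≥0 => eLpNorm (fun ω => f (X t ω) * D t ω - f (X 0 ω) * D₀ ω) 2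
      (hX.pathMeasure μ)) (𝓝[>] 0) (𝓝 0) := by
  have hmp := hX.measurePreserving hμ
  have hfm : ∀ t, AEStronglyMeasurable (fun ω => f (X t ω)) (hX.pathMeasure μ) := fun t =>
    hf.1.comp_measurePreserving (hmp t)
  have hD₀ : Measurable D₀ := measurable_of_tendsto_metrizable' (𝓝[>] (0 : ℝ≥0)) hD
    (tendsto_pi_nhds.2 hlim)
  have hD₀K : ∀ ω, |D₀ ω| ≤ K := fun ω =>
    le_of_tendsto (hlim ω).abs (hle.mono fun t ht => ht ω)
  have h1 : Tendsto (fun t : ℝ≥0 => .ofReal K * eLpNorm (fun ω => f (X t ω) - f (X 0 ω)) 2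
      (hX.pathMeasure μ)) (𝓝[>] 0) (𝓝 0) := by
    simpa using ENNReal.Tendsto.const_mul (hX.tendsto_eLpNorm_comp_sub hμ hf)
      (.inr ENNReal.ofReal_ne_top)
  have h2 : Tendsto (fun t : ℝ≥0 => eLpNorm (fun ω => f (X 0 ω) * (D t ω - D₀ ω)) 2
      (hX.pathMeasure μ)) (𝓝[>] 0) (𝓝 0) := by
    refine tendsto_eLpNorm_two_zero_of_dominated (G := fun ω => f (X 0 ω) * (2 * K))
      (.of_forall fun t => (hfm 0).mul ((hD t).sub hD₀).aestronglyMeasurable)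
      ((hf.comp_measurePreserving (hmp 0)).mul_const (2 * K)) ?_ (ae_of_all _ fun ω => ?_)
    · filter_upwards [hle] with t ht
      refine ae_of_all _ fun ω => ?_
      rw [norm_mul, norm_mul, Real.norm_of_nonneg (by positivity : 0 ≤ 2 * K)]
      gcongr
      calc _ ≤ |D t ω| + |D₀ ω| := abs_sub _ _
        _ ≤ 2 * K := by linarith [ht ω, hD₀K ω]
    · simpa using ((hlim ω).sub_const (D₀ ω)).const_mul (f (X 0 ω))
  refine tendsto_of_tendsto_of_tendsto_of_le_of_le' tendsto_const_nhds
    (by simpa using h1.add h2) (.of_forall fun _ => zero_le) ?_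
  filter_upwards [hle] with t ht
  have e : (fun ω => f (X t ω) * D t ω - f (X 0 ω) * D₀ ω) =
      (fun ω => (f (X t ω) - f (X 0 ω)) * D t ω) + fun ω => f (X 0 ω) * (D t ω - D₀ ω) := by
    ext ω; simp only [Pi.add_apply]; ring
  rw [e]
  refine (eLpNorm_add_le (((hfm t).sub (hfm 0)).mul (hD t).aestronglyMeasurable)
    ((hfm 0).mul ((hD t).sub hD₀).aestronglyMeasurable) (by norm_num)).trans ?_
  refine add_le_add ?_ le_rfl
  refine eLpNorm_le_mul_eLpNorm_of_ae_le_mul (ae_of_all _ fun ω => ?_) 2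
  change ‖(f (X t ω) - f (X 0 ω)) * D t ω‖ ≤ _
  rw [norm_mul, mul_comm]
  gcongr
  exact ht ω

variable {V : 𝓧 → ℝ} {C : ℝ} (hC : ∀ x, |V x| ≤ C)

omit [PolishSpace 𝓧] [TopologicalSpace 𝓧] [MeasurableSpace 𝓧] [BorelSpace 𝓧] mΩ in
include hC in
theorem abs_expFunctional_sub_one_le {t : ℝ≥0} (ht : C * t ≤ 1) (ω : Ω) :
    |expFunctional X V t ω - 1| ≤ 2 * (C * t) := by
  have h := abs_timeIntegral_le (X := X) hC t ω
  exact (Real.abs_exp_sub_one_le (h.trans ht)).trans (by linarith)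

include hX hC

theorem hasDerivWithinAt_expFunctional (hV : Continuous V) (ω : Ω) :
    HasDerivWithinAt (fun t : ℝ => Real.exp (∫ s in (0 : ℝ)..t, V (X s.toNNReal ω)))
      (V (X 0 ω)) (Set.Ici 0) 0 := by
  have hm := hV.measurable.comp (hX.measurable_path ω)
  have hc : ContinuousWithinAt (fun s : ℝ => V (X s.toNNReal ω)) (Set.Ici 0) 0 :=
    hV.continuousAt.comp_continuousWithinAt (hX.continuousWithinAt_toNNReal ω 0)
  have := intervalIntegral.integral_hasDerivWithinAt_right (a := 0) (b := 0)
    (hX.intervalIntegrable_path hV hC ω 0 0) (s := Set.Ici 0) (t := Set.Ioi 0)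
    (hm.stronglyMeasurable.stronglyMeasurableAtFilter)
    (hc.mono Set.Ioi_subset_Ici_self)
  simpa using this.exp

theorem tendsto_expFunctional_sub_one_div (hV : Continuous V) (ω : Ω) :
    Tendsto (fun t : ℝ≥0 => (expFunctional X V t ω - 1) / t) (𝓝[>] 0) (𝓝 (V (X 0 ω))) := by
  have h := (hX.hasDerivWithinAt_expFunctional hC hV ω).Ioi_of_Ici
  rw [hasDerivWithinAt_iff_tendsto_slope' (by simp)] at h
  have h3 : Tendsto (fun r : ℝ≥0 => (r : ℝ)) (𝓝[>] 0) (𝓝[>] 0) := by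
    refine tendsto_nhdsWithin_iff.2 ⟨?_, ?_⟩
    · simpa using (NNReal.continuous_coe.tendsto 0).mono_left nhdsWithin_le_nhds
    · filter_upwards [self_mem_nhdsWithin] with z hz
      simpa using hz
  refine (h.comp h3).congr fun t => ?_
  simp [slope, expFunctional, div_eq_inv_mul]

end IsCadlagMarkovFamily

end StrongContinuity

/-! ### The Feynman–Kac semigroup on real L² and its generator. -/

section FeynmanKacSemigroup

variable {𝓧 Ω : Type*} [TopologicalSpace 𝓧] [PolishSpace 𝓧] [MeasurableSpace 𝓧]
    [BorelSpace 𝓧] {mΩ : MeasurableSpace Ω} {ℱ : Filtration ℝ≥0 mΩ} {X : ℝ≥0 → Ω → 𝓧}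
    {P : 𝓧 → Measure Ω} {p : ℝ≥0 → Kernel 𝓧 𝓧}

omit [TopologicalSpace 𝓧] [PolishSpace 𝓧] [MeasurableSpace 𝓧] [BorelSpace 𝓧] in
theorem expFunctional_nonneg (V : 𝓧 → ℝ) (t : ℝ≥0) (ω : Ω) : 0 ≤ expFunctional X V t ω :=
  (Real.exp_pos _).le

namespace IsCadlagMarkovFamily

variable (hX : IsCadlagMarkovFamily ℱ X P p) {μ : Measure 𝓧} [IsProbabilityMeasure μ]
  (hμ : ∀ t, (p t).Invariant μ) {V : 𝓧 → ℝ} (hV : Continuous V) {C : ℝ} (hC : ∀ x, |V x| ≤ C)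
include hX hμ hV hC

omit [PolishSpace 𝓧] [BorelSpace 𝓧] hV in
-- A crude bound from |V| ≤ C, Jensen and invariance. It makes the operators available before the
-- sharp constant is known.
theorem lintegral_expFunctional_sq_le (t : ℝ≥0) (φ : 𝓧 → ℝ≥0∞) (hφ : Measurable φ) :
    ∫⁻ x, (∫⁻ ω, φ (X t ω) * .ofReal (expFunctional X V t ω) ∂P x) ^ 2 ∂μ ≤
      .ofReal (Real.exp (C * t)) ^ 2 * ∫⁻ x, φ x ^ 2 ∂μ := by
  have hprob := hX.isProbabilityMeasure
  have hφX : Measurable fun ω => φ (X t ω) := hφ.comp (hX.measurable t)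
  calc _ ≤ ∫⁻ x, .ofReal (Real.exp (C * t)) ^ 2 * ∫⁻ ω, φ (X t ω) ^ 2 ∂P x ∂μ := by
        refine lintegral_mono fun x => ?_
        calc _ ≤ (∫⁻ ω, .ofReal (Real.exp (C * t)) * φ (X t ω) ∂P x) ^ 2 := by
              refine pow_le_pow_left' (lintegral_mono fun ω => ?_) 2
              rw [mul_comm]
              exact mul_le_mul' (ENNReal.ofReal_le_ofReal (expFunctional_le hC t ω)) le_rfl
          _ ≤ _ := by
              rw [lintegral_const_mul _ hφX, mul_pow]
              gcongr
              exact sq_lintegral_le_lintegral_sq hφX.aemeasurable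
    _ = _ := by
        rw [lintegral_const_mul'' _ (aemeasurable_lintegral_of_measurable (hX.aemeasurable_apply μ)
          (hφX.pow_const 2)), ← lintegral_mixture_of_measurable _ (hφX.pow_const 2)]
        congr 1
        exact (hX.measurePreserving hμ t).lintegral_comp (hφ.pow_const 2)

theorem exists_operator (t : ℝ≥0) : ∃ T : Lp ℝ 2 μ →L[ℝ] Lp ℝ 2 μ, ‖T‖ ≤ Real.exp (C * t) ∧
    ∀ (f : 𝓧 → ℝ) (hf : MemLp f 2 μ),
      T (hf.toLp f) =ᵐ[μ] fun x => ∫ ω, f (X t ω) * expFunctional X V t ω ∂P x :=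
  exists_weighted_operator (hX.aemeasurable_apply μ) (hX.measurable t)
    (hX.measurable_expFunctional hV.measurable t) (expFunctional_nonneg V t)
    (hX.lintegral_expFunctional_sq_le hμ hC t) (Real.exp_pos _).le

/-- The Feynman–Kac operator on real `L²(μ)` for a bounded continuous potential. -/
noncomputable def fkOperator (t : ℝ≥0) : Lp ℝ 2 μ →L[ℝ] Lp ℝ 2 μ :=
  (hX.exists_operator hμ hV hC t).choose

theorem fkOperator_apply (t : ℝ≥0) {f : 𝓧 → ℝ} (hf : MemLp f 2 μ) :
    hX.fkOperator hμ hV hC t (hf.toLp f) =ᵐ[μ]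
      fun x => ∫ ω, f (X t ω) * expFunctional X V t ω ∂P x :=
  (hX.exists_operator hμ hV hC t).choose_spec.2 f hf

theorem fkOperator_apply_coe (t : ℝ≥0) (f : Lp ℝ 2 μ) :
    hX.fkOperator hμ hV hC t f =ᵐ[μ]
      fun x => ∫ ω, f (X t ω) * expFunctional X V t ω ∂P x := by
  simpa using hX.fkOperator_apply hμ hV hC t (Lp.memLp f)

theorem integrable_comp_mul_expFunctional (t : ℝ≥0) {f : 𝓧 → ℝ} (hf : MemLp f 2 μ) :
    Integrable (fun ω => f (X t ω) * expFunctional X V t ω) (hX.pathMeasure μ) :=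
  integrable_weighted (𝕜 := ℝ) (hX.aemeasurable_apply μ) (hX.measurable t)
    (hX.measurable_expFunctional hV.measurable t) (expFunctional_nonneg V t)
    (hX.lintegral_expFunctional_sq_le hμ hC t) hf

omit [PolishSpace 𝓧] [BorelSpace 𝓧] [IsProbabilityMeasure μ] hμ hV hC in
theorem integral_initial (x : 𝓧) {f : 𝓧 → ℝ} (hf : StronglyMeasurable f) :
    ∫ ω, f (X 0 ω) ∂P x = f x := by
  rw [← integral_map (hX.measurable 0).aemeasurable hf.aestronglyMeasurable, hX.initial,
    integral_dirac' _ _ hf]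

theorem fkOperator_zero (f : Lp ℝ 2 μ) : hX.fkOperator hμ hV hC 0 f = f := by
  refine Lp.ext ((hX.fkOperator_apply_coe hμ hV hC 0 f).trans (ae_of_all _ fun x => ?_))
  simp only [expFunctional_zero, mul_one]
  exact hX.integral_initial x (Lp.stronglyMeasurable f)

theorem fkOperator_add (s t : ℝ≥0) (f : Lp ℝ 2 μ) : hX.fkOperator hμ hV hC (s + t) f =
    hX.fkOperator hμ hV hC s (hX.fkOperator hμ hV hC t f) := by
  have hprob := hX.isProbabilityMeasure
  -- By linearity and density, indicators suffice; these meet the requirement φ ≤ 1 of the Markov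
  -- identity.
  refine Lp.induction (by norm_num) (motive := fun f => hX.fkOperator hμ hV hC (s + t) f =
    hX.fkOperator hμ hV hC s (hX.fkOperator hμ hV hC t f)) ?_ ?_ ?_ f
  · intro c B hB hμB
    rw [Lp.simpleFunc.coe_indicatorConst]
    have hmem : MemLp (B.indicator fun _ => c) 2 μ := memLp_indicator_const 2 hB c (.inr hμB.ne)
    have hf : indicatorConstLp 2 hB hμB.ne c = hmem.toLp _ := rfl
    rw [hf]
    have hWm := fun t => (hX.measurable_expFunctional hV.measurable t).ennreal_ofReal
    have h1m : Measurable (B.indicator (1 : 𝓧 → ℝ≥0∞)) := measurable_one.indicator hB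
    set E : ℝ≥0 → 𝓧 → ℝ≥0∞ := fun t x => ∫⁻ ω, .ofReal (expFunctional X V t ω) *
      B.indicator 1 (X t ω) ∂P x with hE
    have hEm : ∀ t, Measurable fun ω => ENNReal.ofReal (expFunctional X V t ω) *
      B.indicator (1 : 𝓧 → ℝ≥0∞) (X t ω) := fun t => (hWm t).mul (h1m.comp (hX.measurable t))
    have hint : ∀ t x, ∫ ω, B.indicator (fun _ => c) (X t ω) * expFunctional X V t ω ∂P x =
        c * (E t x).toReal := by
      intro t x
      rw [hE, ← integral_toReal (hEm t).aemeasurable, ← integral_const_mul]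
      · refine integral_congr_ae (ae_of_all _ fun ω => ?_)
        by_cases h : X t ω ∈ B <;> simp [h, ENNReal.toReal_ofReal (expFunctional_nonneg V t ω)]
      · refine ae_of_all _ fun ω => ?_
        by_cases h : X t ω ∈ B <;> simp [h]
    have hEt : ∀ x, E t x < ∞ := fun x => by
      calc E t x ≤ ∫⁻ _, .ofReal (Real.exp (C * t)) * 1 ∂P x := by
            refine lintegral_mono fun ω => mul_le_mul' ?_ ?_
            · exact ENNReal.ofReal_le_ofReal (expFunctional_le hC t ω)
            · by_cases h : X t ω ∈ B <;> simp [h]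
        _ < ∞ := by simp
    have h1 := hX.fkOperator_apply hμ hV hC t hmem
    simp only [hint] at h1
    have hgm : MemLp (fun x => c * (E t x).toReal) 2 μ := (Lp.memLp _).ae_eq h1
    have h2 : hX.fkOperator hμ hV hC t (hmem.toLp _) = hgm.toLp _ := by
      refine Lp.ext (h1.trans hgm.coeFn_toLp.symm)
    rw [h2]
    refine Lp.ext ((hX.fkOperator_apply hμ hV hC (s + t) hmem).trans
      (EventuallyEq.trans (ae_of_all _ fun x => ?_) (hX.fkOperator_apply hμ hV hC s hgm).symm))
    refine (hint _ _).trans ?_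
    have hadd := hX.lintegral_expFunctional_add hV hC x s t h1m
      (fun x => by by_cases h : x ∈ B <;> simp [h])
    simp only [mul_assoc]
    rw [integral_const_mul]
    congr 1
    change (∫⁻ ω, _ ∂P x).toReal = _
    rw [hadd, ← integral_toReal]
    · refine integral_congr_ae (ae_of_all _ fun ω => ?_)
      simp only [ENNReal.toReal_mul, ENNReal.toReal_ofReal (expFunctional_nonneg V s ω), hE]
      ring
    -- E t is not known to be Borel. Universal measurability is applied to the law of X_s under P x,
    -- which is the measure relevant here.
    · have : IsProbabilityMeasure ((P x).map (X s)) :=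
        Measure.isProbabilityMeasure_map (hX.measurable s).aemeasurable
      have := aemeasurable_lintegral_of_measurable (hX.aemeasurable_apply ((P x).map (X s))) (hEm t)
      exact (hWm s).aemeasurable.mul (this.comp_measurable (hX.measurable s))
    · exact ae_of_all _ fun ω => ENNReal.mul_lt_top (by simp) (hEt _)
  · intro f g hf hg _ h1 h2
    simp only [map_add]
    rw [h1, h2]
  · exact isClosed_eq (by fun_prop) (by fun_prop)

theorem tendsto_fkOperator (f : Lp ℝ 2 μ) :
    Tendsto (fun t => hX.fkOperator hμ hV hC t f) (𝓝[>] 0) (𝓝 f) := by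
  have hC0 : 0 ≤ C := by
    obtain ⟨x⟩ := nonempty_of_isProbabilityMeasure μ
    exact (abs_nonneg _).trans (hC x)
  have hsmall : ∀ᶠ t : ℝ≥0 in 𝓝[>] 0, C * t < 1 := by
    have : Tendsto (fun t : ℝ≥0 => C * t) (𝓝[>] 0) (𝓝 0) := by
      simpa using ((NNReal.continuous_coe.tendsto 0).mono_left nhdsWithin_le_nhds).const_mul C
    exact this.eventually_lt_const one_pos
  -- K = 3 works because Ct < 1 for small t, whence the functional differs from 1 by at most 2.
  have hlim := hX.tendsto_eLpNorm_comp_mul_sub hμ (Lp.memLp f)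
    (D := expFunctional X V) (D₀ := fun _ => 1)
    (hX.measurable_expFunctional hV.measurable) (K := 3) (by norm_num) ?_ fun ω => ?_
  · rw [Lp.tendsto_Lp_iff_tendsto_eLpNorm']
    refine tendsto_of_tendsto_of_tendsto_of_le_of_le' tendsto_const_nhds hlim
      (.of_forall fun _ => zero_le) (.of_forall fun t => ?_)
    have hi := hX.integrable_comp_mul_expFunctional hμ hV hC t (Lp.memLp f)
    have hm0 : AEStronglyMeasurable (fun ω => f (X 0 ω) * 1) (hX.pathMeasure μ) :=
      ((Lp.stronglyMeasurable f).comp_measurable (hX.measurable 0)).aestronglyMeasurable.mul_const 1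
    have hi0 : Integrable (fun ω => f (X 0 ω) * 1) (hX.pathMeasure μ) := by
      simpa only [expFunctional_zero] using
        hX.integrable_comp_mul_expFunctional hμ hV hC 0 (Lp.memLp f)
    refine le_trans (le_of_eq (eLpNorm_congr_ae ?_))
      (eLpNorm_integral_le (hX.aemeasurable_apply μ) hX.isProbabilityMeasure (hi.1.sub hm0))
    filter_upwards [Lp.coeFn_sub (hX.fkOperator hμ hV hC t f) f,
      hX.fkOperator_apply_coe hμ hV hC t f, ae_integrable_of_mixture _ hi,
      ae_integrable_of_mixture _ hi0] with x h1 h2 h3 h4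
    simp only [Pi.sub_apply] at h1 ⊢
    rw [integral_sub h3 h4, ← h2]
    simp only [mul_one]
    rw [hX.integral_initial x (Lp.stronglyMeasurable f)]
  · filter_upwards [hsmall] with t ht ω
    have := abs_expFunctional_sub_one_le (X := X) hC ht.le ω
    rw [abs_of_nonneg (expFunctional_nonneg V t ω)]
    linarith [le_abs_self (expFunctional X V t ω - 1)]
  · have h0 : Tendsto (fun t : ℝ≥0 => 2 * (C * t)) (𝓝[>] 0) (𝓝 0) := by
      simpa using (((NNReal.continuous_coe.tendsto 0).mono_left nhdsWithin_le_nhds).const_mul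
        C).const_mul 2
    have : Tendsto (fun t : ℝ≥0 => expFunctional X V t ω - 1) (𝓝[>] 0) (𝓝 0) := by
      refine squeeze_zero_norm' ?_ h0
      filter_upwards [hsmall] with t ht
      exact abs_expFunctional_sub_one_le hC ht.le ω
    simpa using this.add_const 1

theorem isStrongSemigroup_fkOperator : IsStrongSemigroup (hX.fkOperator hμ hV hC) C where
  zero := hX.fkOperator_zero hμ hV hC
  add := hX.fkOperator_add hμ hV hC
  bound t f := ((hX.fkOperator hμ hV hC t).le_opNorm f).trans (by
    gcongr
    exact (hX.exists_operator hμ hV hC t).choose_spec.1)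
  cont := hX.tendsto_fkOperator hμ hV hC

omit hX hμ hV hC [PolishSpace 𝓧] [TopologicalSpace 𝓧] [BorelSpace 𝓧]
  [IsProbabilityMeasure μ] [MeasurableSpace 𝓧] in
theorem feynmanKac_zero_ofReal (t : ℝ≥0) (f : 𝓧 → ℝ) (x : 𝓧) :
    feynmanKac X P 0 t (fun x => (f x : ℂ)) x = ((∫ ω, f (X t ω) ∂P x : ℝ) : ℂ) := by
  simp only [feynmanKac, feynmanKacIntegrand, Pi.zero_apply, intervalIntegral.integral_zero,
    Real.exp_zero, Complex.ofReal_one, mul_one]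
  exact integral_complex_ofReal

/-- The generator of the Feynman–Kac semigroup is `A + V`. -/
theorem hasGenerator_sub {f h : Lp ℝ 2 μ}
    (hf : Tendsto (fun r : ℝ≥0 => (r : ℝ)⁻¹ • (hX.fkOperator hμ hV hC r f - f)) (𝓝[>] 0) (𝓝 h)) :
    HasGenerator X P μ (fun x => (f x : ℂ)) (fun x => ((h x - V x * f x : ℝ) : ℂ)) := by
  have hC0 : 0 ≤ C := by
    obtain ⟨x⟩ := nonempty_of_isProbabilityMeasure μ
    exact (abs_nonneg _).trans (hC x)
  have hVf : MemLp (fun x => V x * f x) 2 μ :=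
    (Lp.memLp f).of_le_mul (c := C) (hV.measurable.aestronglyMeasurable.mul (Lp.aestronglyMeasurable f))
      (ae_of_all _ fun x => by rw [norm_mul]; gcongr; exact hC x)
  refine ⟨(Lp.memLp f).ofReal, ((Lp.memLp h).sub hVf).ofReal, ?_⟩
  rw [Lp.tendsto_Lp_iff_tendsto_eLpNorm'] at hf
  -- With S the Feynman–Kac and P the unweighted semigroup, (P_r f - f)/r - (h - Vf) is (S_r f -
  -- f)/r - h minus E^x[G], where G compares f(X_r)(exp - 1)/r with f(X_0)V(X_0). Both parts vanish
  -- in L². K = 2C bounds (exp - 1)/r for small r.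
  have hlim := hX.tendsto_eLpNorm_comp_mul_sub hμ (Lp.memLp f)
    (D := fun t ω => (expFunctional X V t ω - 1) / t) (D₀ := fun ω => V (X 0 ω))
    (fun t => ((hX.measurable_expFunctional hV.measurable t).sub_const 1).div_const _)
    (K := 2 * C) (by positivity) ?_ (hX.tendsto_expFunctional_sub_one_div hC hV)
  · have hsum := hf.add hlim
    rw [add_zero] at hsum
    refine tendsto_of_tendsto_of_tendsto_of_le_of_le' tendsto_const_nhds hsum
      (.of_forall fun _ => zero_le) ?_
    filter_upwards [self_mem_nhdsWithin] with r hr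
    have hr0 : (r : ℝ) ≠ 0 := by exact_mod_cast (Set.mem_Ioi.1 hr).ne'
    set G : Ω → ℝ := fun ω => f (X r ω) * ((expFunctional X V r ω - 1) / r) - f (X 0 ω) * V (X 0 ω)
    have hfm : ∀ t, StronglyMeasurable fun ω => f (X t ω) := fun t =>
      (Lp.stronglyMeasurable f).comp_measurable (hX.measurable t)
    have hGm : AEStronglyMeasurable G (hX.pathMeasure μ) :=
      (((hfm r).mul ((((hX.measurable_expFunctional hV.measurable r).sub_const 1).div_const
        _).stronglyMeasurable)).sub ((hfm 0).mul
        (hV.measurable.comp (hX.measurable 0)).stronglyMeasurable)).aestronglyMeasurable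
    have hiV := hX.integrable_comp_mul_expFunctional hμ hV hC r (Lp.memLp f)
    have hi : Integrable (fun ω => f (X r ω)) (hX.pathMeasure μ) :=
      ((Lp.memLp f).comp_measurePreserving (hX.measurePreserving hμ r)).integrable (by norm_num)
    have hi0 : Integrable (fun ω => V (X 0 ω) * f (X 0 ω)) (hX.pathMeasure μ) :=
      (hVf.comp_measurePreserving (hX.measurePreserving hμ 0)).integrable (by norm_num)
    refine le_trans ?_ (add_le_add_right
      (eLpNorm_integral_le (hX.aemeasurable_apply μ) hX.isProbabilityMeasure hGm) _)
    have hsm : AEStronglyMeasurable (fun x => ∫ ω, G ω ∂P x) μ := by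
      refine aestronglyMeasurable_integral (hX.aemeasurable_apply μ) ?_
      refine ((hiV.sub hi).div_const (r : ℝ) |>.sub hi0).congr (ae_of_all _ fun ω => ?_)
      simp only [G, Pi.sub_apply]
      ring
    refine le_trans (le_of_eq ?_) (eLpNorm_sub_le
      ((Lp.aestronglyMeasurable _).sub (Lp.aestronglyMeasurable h)) hsm (by norm_num))
    refine eLpNorm_congr_norm_ae ?_
    filter_upwards [
      Lp.coeFn_smul (r : ℝ)⁻¹ (hX.fkOperator hμ hV hC r f - f),
      Lp.coeFn_sub (hX.fkOperator hμ hV hC r f) f,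
      hX.fkOperator_apply_coe hμ hV hC r f, ae_integrable_of_mixture _ hiV,
      ae_integrable_of_mixture _ hi, ae_integrable_of_mixture _ hi0] with x h2 h3 h4 h5 h6 h7
    rw [feynmanKac_zero_ofReal]
    have hVfx : ∫ ω, V (X 0 ω) * f (X 0 ω) ∂P x = V x * f x :=
      hX.integral_initial x (f := fun y => V y * f y)
        (hV.measurable.stronglyMeasurable.mul (Lp.stronglyMeasurable f))
    have hG : ∫ ω, G ω ∂P x = ((hX.fkOperator hμ hV hC r f) x - ∫ ω, f (X r ω) ∂P x) / r - V x * f x := by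
      rw [h4, ← hVfx, ← integral_sub h5 h6, ← integral_div, ← integral_sub _ h7]
      · congr with ω
        simp only [G]
        ring
      · exact (h5.sub h6).div_const _
    rw [Pi.sub_apply, Pi.sub_apply, h2, Pi.smul_apply, h3, Pi.sub_apply, hG, smul_eq_mul]
    rw [← Complex.ofReal_sub, ← Complex.ofReal_div, ← Complex.ofReal_sub, Complex.norm_real]
    congr 1
    field_simp
    ring
  · have : Tendsto (fun t : ℝ≥0 => C * t) (𝓝[>] 0) (𝓝 0) := by
      simpa using ((NNReal.continuous_coe.tendsto 0).mono_left nhdsWithin_le_nhds).const_mul C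
    filter_upwards [this.eventually_lt_const one_pos, self_mem_nhdsWithin] with t ht ht0 ω
    have ht0' : (0 : ℝ) < t := by exact_mod_cast Set.mem_Ioi.1 ht0
    rw [abs_div, abs_of_pos ht0', div_le_iff₀ ht0']
    exact (abs_expFunctional_sub_one_le hC ht.le ω).trans (by linarith)

end IsCadlagMarkovFamily

end FeynmanKacSemigroup

/-! ### Log-Sobolev and Gibbs inequalities: the sharp bound for bounded potentials. -/

section LogSobolev

/-- Young's inequality for the entropy: 1 + u ≤ e^u at u = b - log a, multiplied by a. The case a =
0 is trivial. -/
theorem mul_sub_log_le_exp {a b : ℝ} (ha : 0 ≤ a) : a * (b - Real.log a) ≤ Real.exp b - a := by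
  rcases ha.eq_or_lt with rfl | ha
  · simpa using (Real.exp_pos b).le
  · have h := Real.add_one_le_exp (b - Real.log a)
    rw [Real.exp_sub, Real.exp_log ha] at h
    calc _ ≤ a * (Real.exp b / a - 1) := mul_le_mul_of_nonneg_left (by linarith) ha.le
      _ = _ := by field_simp

/-- The Gibbs variational inequality. -/
theorem integral_mul_sub_entropy_le_log_integral_exp {α : Type*} [MeasurableSpace α] {μ : Measure α}
    [NeZero μ] {q U : α → ℝ} (hq : ∀ x, 0 ≤ q x) (hq1 : ∫ x, q x ∂μ = 1)
    (hqi : Integrable q μ) (hqU : Integrable (fun x => q x * U x) μ)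
    (hent : Integrable (fun x => q x * Real.log (q x)) μ)
    (hexp : Integrable (fun x => Real.exp (U x)) μ) :
    ∫ x, q x * U x ∂μ - ∫ x, q x * Real.log (q x) ∂μ ≤ Real.log (∫ x, Real.exp (U x) ∂μ) := by
  set L := Real.log (∫ x, Real.exp (U x) ∂μ) with hL
  have hpos : 0 < ∫ x, Real.exp (U x) ∂μ := integral_exp_pos hexp
  -- Pointwise Young inequality with b = U - L. The right side integrates to 0, since e^{U-L} and q
  -- both have integral 1.
  have h1 : ∫ x, (q x * U x - q x * Real.log (q x) - q x * L) ∂μ ≤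
      ∫ x, (Real.exp (U x) * Real.exp (-L) - q x) ∂μ := by
    refine integral_mono ((hqU.sub hent).sub (hqi.mul_const L)) ((hexp.mul_const _).sub hqi)
      fun x => ?_
    have := mul_sub_log_le_exp (b := U x - L) (hq x)
    rw [sub_eq_add_neg (U x), Real.exp_add] at this
    simp only
    linarith
  rw [integral_sub (f := fun x => q x * U x - q x * Real.log (q x)) (hqU.sub hent) (hqi.mul_const L), integral_sub hqU hent,
    integral_sub (hexp.mul_const _) hqi, integral_mul_const, integral_mul_const, hq1,
    Real.exp_neg, hL, Real.exp_log hpos, mul_inv_cancel₀ hpos.ne'] at h1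
  linarith

theorem integrable_exp_of_bounded {α : Type*} [MeasurableSpace α] {μ : Measure α}
    [IsFiniteMeasure μ] {V : α → ℝ} (hV : Measurable V) {C : ℝ} (hC : ∀ x, |V x| ≤ C)
    {β : ℝ} (hβ : 0 < β) : Integrable (fun x => Real.exp (β * V x)) μ := by
  refine Integrable.of_bound (C := Real.exp (β * C))
    (Real.measurable_exp.comp (hV.const_mul β)).aestronglyMeasurable (ae_of_all _ fun x => ?_)
  rw [Real.norm_of_nonneg (Real.exp_pos _).le, Real.exp_le_exp]
  gcongr
  exact (le_abs_self _).trans (hC x)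

variable {𝓧 Ω : Type*} [TopologicalSpace 𝓧] [PolishSpace 𝓧] [MeasurableSpace 𝓧]
    [BorelSpace 𝓧] {mΩ : MeasurableSpace Ω} {ℱ : Filtration ℝ≥0 mΩ} {X : ℝ≥0 → Ω → 𝓧}
    {P : 𝓧 → Measure Ω} {p : ℝ≥0 → Kernel 𝓧 𝓧}

namespace IsCadlagMarkovFamily

variable (hX : IsCadlagMarkovFamily ℱ X P p) {μ : Measure 𝓧} [IsProbabilityMeasure μ]
  (hμ : ∀ t, (p t).Invariant μ) {V : 𝓧 → ℝ} (hV : Continuous V) {C : ℝ} (hC : ∀ x, |V x| ≤ C)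
  {β : ℝ} (hβ : 0 < β) (hLS : LogSobolevInequality X P μ β)
include hX hμ hV hC hβ hLS

/-- Log-Sobolev applies to f with Af = h - Vf. The resulting term ∫ f²·βV dμ minus the entropy of f²
is controlled by Gibbs with density f² and U = βV. -/
theorem inner_generator_le {f h : Lp ℝ 2 μ}
    (hf : Tendsto (fun r : ℝ≥0 => (r : ℝ)⁻¹ • (hX.fkOperator hμ hV hC r f - f)) (𝓝[>] 0) (𝓝 h))
    (hf1 : ‖f‖ = 1) : inner ℝ h f ≤ Real.log (∫ x, Real.exp (β * V x) ∂μ) / β := by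
  have hn : eLpNorm f 2 μ = 1 := by
    rw [Lp.norm_def] at hf1
    rw [← ENNReal.ofReal_toReal (Lp.eLpNorm_ne_top f), hf1, ENNReal.ofReal_one]
  obtain ⟨hent, hle⟩ := hLS _ _ (hX.hasGenerator_sub hμ hV hC hf) hn
  have hfi : Integrable (fun x => f x ^ 2) μ := (Lp.memLp f).integrable_sq
  have hf2 : ∫ x, f x ^ 2 ∂μ = 1 := by
    have : inner ℝ f f = (1 : ℝ) := by rw [real_inner_self_eq_norm_sq, hf1, one_pow]
    rw [← this, L2.inner_def]
    simp [sq]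
  have hVf : Integrable (fun x => f x ^ 2 * (β * V x)) μ := by
    refine hfi.mul_bdd (c := β * C) (hV.measurable.const_mul β).aestronglyMeasurable
      (ae_of_all _ fun x => ?_)
    rw [norm_mul, Real.norm_of_nonneg hβ.le]
    gcongr
    exact hC x
  have hexp := integrable_exp_of_bounded (μ := μ) hV.measurable hC hβ
  have hG := integral_mul_sub_entropy_le_log_integral_exp (fun x => sq_nonneg (f x)) hf2 hfi hVf hent hexp
  have hhf : Integrable (fun x => h x * f x) μ := (Lp.memLp h).integrable_mul (Lp.memLp f)
  have hin : inner ℝ h f = ∫ x, h x * f x ∂μ := by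
    rw [L2.inner_def]
    refine integral_congr_ae (ae_of_all _ fun x => ?_)
    simp [mul_comm]
  have hsplit : ∫ x, (h x - V x * f x) * f x ∂μ =
      ∫ x, h x * f x ∂μ - β⁻¹ * ∫ x, f x ^ 2 * (β * V x) ∂μ := by
    rw [← integral_const_mul, ← integral_sub hhf (hVf.const_mul _)]
    refine integral_congr_ae (ae_of_all _ fun x => ?_)
    simp only
    field_simp
  rw [hsplit] at hle
  rw [hin, le_div_iff₀ hβ]
  have e : -β * (∫ x, h x * f x ∂μ - β⁻¹ * ∫ x, f x ^ 2 * (β * V x) ∂μ) =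
    -β * ∫ x, h x * f x ∂μ + ∫ x, f x ^ 2 * (β * V x) ∂μ := by
    generalize ∫ x, h x * f x ∂μ = a
    generalize ∫ x, f x ^ 2 * (β * V x) ∂μ = b
    field_simp
    ring
  rw [e] at hle
  linarith

theorem norm_fkOperator_le (t : ℝ≥0) (f : Lp ℝ 2 μ) :
    ‖hX.fkOperator hμ hV hC t f‖ ≤ (∫ x, Real.exp (β * V x) ∂μ) ^ ((t : ℝ) / β) * ‖f‖ := by
  have h := (hX.isStrongSemigroup_fkOperator hμ hV hC).norm_le
    (fun f h hf hf1 => hX.inner_generator_le hμ hV hC hβ hLS hf hf1) f t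
  have hexp := integrable_exp_of_bounded (μ := μ) hV.measurable hC hβ
  rw [Real.rpow_def_of_pos (integral_exp_pos hexp)]
  refine h.trans_eq ?_
  congr 2
  ring

/-- The operator bound recast for [0,∞]-valued φ, the form to which Fatou applies. When ∫ φ² dμ is
finite, φ is a.e. finite, and by stationarity so is φ(X_t). -/
theorem lintegral_sq_le_of_logSobolev (t : ℝ≥0) {φ : 𝓧 → ℝ≥0∞} (hφ : Measurable φ) :
    ∫⁻ x, (∫⁻ ω, φ (X t ω) * .ofReal (expFunctional X V t ω) ∂P x) ^ 2 ∂μ ≤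
      .ofReal ((∫ x, Real.exp (β * V x) ∂μ) ^ ((t : ℝ) / β)) ^ 2 * ∫⁻ x, φ x ^ 2 ∂μ := by
  have hexp := integrable_exp_of_bounded (μ := μ) hV.measurable hC hβ
  set c := (∫ x, Real.exp (β * V x) ∂μ) ^ ((t : ℝ) / β)
  have hc : 0 < c := Real.rpow_pos_of_pos (integral_exp_pos hexp) _
  by_cases htop : ∫⁻ x, φ x ^ 2 ∂μ = ∞
  · rw [htop, ENNReal.mul_top (by simpa using hc)]
    exact le_top
  have hφt : ∀ᵐ x ∂μ, φ x < ∞ := by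
    filter_upwards [ae_lt_top (hφ.pow_const 2) htop] with x hx
    by_contra h
    rw [not_lt, top_le_iff] at h
    simp [h] at hx
  set f : 𝓧 → ℝ := fun x => (φ x).toReal with hfdef
  have hfφ : ∀ᵐ x ∂μ, ‖f x‖ₑ = φ x := by
    filter_upwards [hφt] with x hx
    rw [Real.enorm_of_nonneg ENNReal.toReal_nonneg, ENNReal.ofReal_toReal hx.ne]
  have hfe : eLpNorm f 2 μ ^ 2 = ∫⁻ x, φ x ^ 2 ∂μ := by
    rw [eLpNorm_two_sq]
    exact lintegral_congr_ae (hfφ.mono fun x hx => by simp only [hx])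
  have hf : MemLp f 2 μ := by
    refine ⟨hφ.ennreal_toReal.aestronglyMeasurable, ?_⟩
    by_contra h
    rw [not_lt, top_le_iff] at h
    rw [h] at hfe
    exact htop (by simpa using hfe.symm)
  have hi := hX.integrable_comp_mul_expFunctional hμ hV hC t hf
  have hmp := hX.measurePreserving hμ t
  have hae := ae_ae_of_ae_mixture (hX.aemeasurable_apply μ) (hmp.quasiMeasurePreserving.ae hfφ)
  have hop : _ ≤ c * _ := hX.norm_fkOperator_le hμ hV hC hβ hLS t (hf.toLp f)
  have hop' : eLpNorm (fun x => ∫ ω, f (X t ω) * expFunctional X V t ω ∂P x) 2 μ ≤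
      .ofReal c * eLpNorm f 2 μ := by
    rw [← eLpNorm_congr_ae (hX.fkOperator_apply hμ hV hC t hf), ← eLpNorm_congr_ae hf.coeFn_toLp]
    rw [Lp.norm_def, Lp.norm_def, ← ENNReal.toReal_ofReal hc.le, ← ENNReal.toReal_mul] at hop
    exact (ENNReal.toReal_le_toReal (Lp.eLpNorm_ne_top _) (ENNReal.mul_ne_top (by simp)
      (Lp.eLpNorm_ne_top _))).1 hop
  calc _ = ∫⁻ x, ‖∫ ω, f (X t ω) * expFunctional X V t ω ∂P x‖ₑ ^ 2 ∂μ := by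
        refine lintegral_congr_ae ?_
        filter_upwards [hae, ae_integrable_of_mixture _ hi] with x h1 h2
        have h0 : ∀ ω, 0 ≤ f (X t ω) * expFunctional X V t ω := fun ω =>
          mul_nonneg ENNReal.toReal_nonneg (expFunctional_nonneg V t ω)
        rw [Real.enorm_of_nonneg (integral_nonneg h0),
          ofReal_integral_eq_lintegral_ofReal h2 (ae_of_all _ h0)]
        congr 1
        refine lintegral_congr_ae (h1.mono fun ω hω => ?_)
        rw [Real.enorm_of_nonneg ENNReal.toReal_nonneg] at hω
        simp only
        rw [ENNReal.ofReal_mul ENNReal.toReal_nonneg, hω]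
    _ = eLpNorm (fun x => ∫ ω, f (X t ω) * expFunctional X V t ω ∂P x) 2 μ ^ 2 :=
        (eLpNorm_two_sq _ _).symm
    _ ≤ (.ofReal c * eLpNorm f 2 μ) ^ 2 := by gcongr
    _ = _ := by rw [mul_pow, hfe]

end IsCadlagMarkovFamily

end LogSobolev

/-! ### Approximating the potential by bounded continuous functions. -/

section Approximation

/-- Convexity puts e^{βb} above the tangent line at a, so only a needs an upper bound. -/
theorem exp_mul_le_exp_mul_add {β N a b : ℝ} (hβ : 0 ≤ β) (ha : a ≤ N) :
    Real.exp (β * a) ≤ Real.exp (β * b) + Real.exp (β * N) * β * |b - a| := by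
  have h1 := Real.add_one_le_exp (β * b - β * a)
  have h2 : Real.exp (β * b) = Real.exp (β * a) * Real.exp (β * b - β * a) := by
    rw [← Real.exp_add]; congr 1; ring
  have h3 : Real.exp (β * a) ≤ Real.exp (β * N) := Real.exp_le_exp.2 (by gcongr)
  have h4 : β * (a - b) ≤ β * |b - a| := by
    gcongr
    rw [abs_sub_comm]
    exact le_abs_self _
  have h5 : Real.exp (β * a) * (β * (a - b)) ≤ Real.exp (β * N) * (β * |b - a|) :=
    (mul_le_mul_of_nonneg_left h4 (Real.exp_pos _).le).trans
      (mul_le_mul_of_nonneg_right h3 (by positivity))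
  have h6 := mul_le_mul_of_nonneg_left h1 (Real.exp_pos (β * a)).le
  rw [← h2] at h6
  linarith

/-- Approximation of a potential by bounded continuous ones, in `L¹` and with control of the
exponential moment. -/
theorem exists_bounded_continuous_approx {𝓧 : Type*} [TopologicalSpace 𝓧] [PolishSpace 𝓧]
    [MeasurableSpace 𝓧] [BorelSpace 𝓧] {μ : Measure 𝓧} [IsProbabilityMeasure μ] {β : ℝ}
    (hβ : 0 < β) {V : 𝓧 → ℝ} (hVm : Measurable V) (hV : Integrable V μ)
    (hexp : Integrable (fun x => Real.exp (β * V x)) μ) {ε : ℝ} (hε : 0 < ε) :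
    ∃ (W : 𝓧 → ℝ) (C : ℝ), Continuous W ∧ (∀ x, |W x| ≤ C) ∧ ∫ x, |V x - W x| ∂μ ≤ ε ∧
      ∫ x, Real.exp (β * W x) ∂μ ≤ ∫ x, Real.exp (β * V x) ∂μ + ε := by
  let := TopologicalSpace.upgradeIsCompletelyMetrizable 𝓧
  have hclamp : ∀ (N : ℕ) (a : ℝ), |max (-(N : ℝ)) (min a N)| ≤ N := fun N a => by
    have : (0 : ℝ) ≤ N := N.cast_nonneg
    rw [abs_le]
    exact ⟨le_max_left _ _, max_le (by linarith) (min_le_right _ _)⟩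
  have hlip : ∀ (N : ℕ) (a b : ℝ), |max (-(N : ℝ)) (min a N) - max (-(N : ℝ)) (min b N)| ≤ |a - b| :=
    fun N a b => (abs_max_sub_max_le_max _ _ _ _).trans <| by
      simpa using (abs_min_sub_min_le_max a N b N)
  have hclampm : ∀ N : ℕ, Measurable fun x => max (-(N : ℝ)) (min (V x) N) := fun N =>
    measurable_const.max (hVm.min measurable_const)
  have hev : ∀ x, ∀ᶠ N : ℕ in atTop, max (-(N : ℝ)) (min (V x) N) = V x := fun x => by
    filter_upwards [tendsto_natCast_atTop_atTop.eventually_ge_atTop |V x|] with N hN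
    rw [min_eq_left ((le_abs_self _).trans hN), max_eq_right (by linarith [neg_abs_le (V x)])]
  have h1 : Tendsto (fun N : ℕ => ∫ x, |V x - max (-(N : ℝ)) (min (V x) N)| ∂μ) atTop (𝓝 0) := by
    have : Tendsto (fun N : ℕ => ∫ x, |V x - max (-(N : ℝ)) (min (V x) N)| ∂μ) atTop
        (𝓝 (∫ _, (0 : ℝ) ∂μ)) := by
      refine tendsto_integral_of_dominated_convergence (fun x => |V x|)
        (fun N => (hVm.sub (hclampm N)).abs.aestronglyMeasurable) hV.abs (fun N => ae_of_all _ fun x => ?_)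
        (ae_of_all _ fun x => ?_)
      · have : (0 : ℝ) ≤ N := N.cast_nonneg
        rw [Real.norm_eq_abs, abs_abs]
        rcases le_total (V x) N with h | h
        · rw [min_eq_left h]
          rcases le_total (-(N : ℝ)) (V x) with h' | h'
          · simp [max_eq_right h']
          · rw [max_eq_left h', abs_of_nonpos (by linarith), abs_of_nonpos (by linarith)]
            linarith
        · rw [min_eq_right h, max_eq_right (by linarith), abs_of_nonneg (by linarith),
            abs_of_nonneg (by linarith)]
          linarith
      · refine tendsto_const_nhds.congr' ?_
        filter_upwards [hev x] with N hN
        simp [hN]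
    simpa using this
  have h2 : Tendsto (fun N : ℕ => ∫ x, Real.exp (β * max (-(N : ℝ)) (min (V x) N)) ∂μ) atTop
      (𝓝 (∫ x, Real.exp (β * V x) ∂μ)) := by
    refine tendsto_integral_of_dominated_convergence (fun x => Real.exp (β * V x) + 1)
      (fun N => (Real.measurable_exp.comp ((hclampm N).const_mul β)).aestronglyMeasurable)
      (hexp.add (integrable_const 1)) (fun N => ae_of_all _ fun x => ?_) (ae_of_all _ fun x => ?_)
    · rw [Real.norm_of_nonneg (Real.exp_pos _).le]
      rcases le_total (V x) (-(N : ℝ)) with h | h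
      · have : max (-(N : ℝ)) (min (V x) N) ≤ 0 := by
          have : (0 : ℝ) ≤ N := N.cast_nonneg
          exact max_le (by linarith) ((min_le_left _ _).trans (by linarith))
        have h0 : Real.exp (β * max (-(N : ℝ)) (min (V x) N)) ≤ 1 :=
          Real.exp_le_one_iff.2 (mul_nonpos_of_nonneg_of_nonpos hβ.le this)
        linarith [Real.exp_pos (β * V x)]
      · have : max (-(N : ℝ)) (min (V x) N) ≤ V x := max_le h (min_le_left _ _)
        have h0 : Real.exp (β * max (-(N : ℝ)) (min (V x) N)) ≤ Real.exp (β * V x) :=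
          Real.exp_le_exp.2 (by gcongr)
        linarith
    · refine tendsto_const_nhds.congr' ?_
      filter_upwards [hev x] with N hN
      rw [hN]
  obtain ⟨N, hN1, hN2⟩ := ((h1.eventually_lt_const (half_pos hε)).and
    (h2.eventually_lt_const (lt_add_of_pos_right _ (half_pos hε)))).exists
  set U : 𝓧 → ℝ := fun x => max (-(N : ℝ)) (min (V x) N) with hU
  have hUi : Integrable U μ := Integrable.of_bound (hclampm N).aestronglyMeasurable N
    (ae_of_all _ fun x => hclamp N _)
  set K : ℝ := Real.exp (β * N) * β with hK
  have hKpos : 0 < K := by positivity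
  -- The first entry serves the L¹ distance; the second serves the exponential moment, where the L¹
  -- error is multiplied by K.
  set δ : ℝ := min (ε / 2) (ε / 2 / K) with hδ
  have hδpos : 0 < δ := lt_min (by positivity) (by positivity)
  obtain ⟨g, hg, -⟩ := hUi.exists_boundedContinuous_integral_sub_le hδpos
  -- Truncating g at the same level keeps W ≤ N, so K does not depend on g. Truncation is
  -- 1-Lipschitz and fixes U, so the L¹ error does not grow.
  set W : 𝓧 → ℝ := fun x => max (-(N : ℝ)) (min (g x) N) with hW
  have hWc : Continuous W := continuous_const.max (g.continuous.min continuous_const)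
  have hWi : Integrable W μ := Integrable.of_bound hWc.measurable.aestronglyMeasurable N
    (ae_of_all _ fun x => hclamp N _)
  have hgi : Integrable g μ := g.integrable μ
  have hUWi : Integrable (fun x => |U x - W x|) μ := (hUi.sub hWi).abs
  have hUW : ∫ x, |U x - W x| ∂μ ≤ δ := by
    refine le_trans (integral_mono (hUi.sub hWi).abs (hUi.sub hgi).norm fun x => ?_) hg
    have e : U x = max (-(N : ℝ)) (min (U x) N) := by
      have := abs_le.1 (hclamp N (V x))
      rw [min_eq_left this.2, max_eq_right this.1]
    have h := hlip N (U x) (g x)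
    rwa [← e] at h
  refine ⟨W, N, hWc, fun x => hclamp N _, ?_, ?_⟩
  · calc ∫ x, |V x - W x| ∂μ ≤ ∫ x, (|V x - U x| + |U x - W x|) ∂μ :=
          integral_mono (hV.sub hWi).abs ((hV.sub hUi).abs.add (hUi.sub hWi).abs)
            fun x => abs_sub_le _ _ _
      _ = ∫ x, |V x - U x| ∂μ + ∫ x, |U x - W x| ∂μ :=
          integral_add (hV.sub hUi).abs (hUi.sub hWi).abs
      _ ≤ ε / 2 + ε / 2 := add_le_add hN1.le (hUW.trans (min_le_left _ _))
      _ = ε := add_halves ε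
  · have heU : Integrable (fun x => Real.exp (β * U x)) μ := integrable_exp_of_bounded (μ := μ) (hclampm N) (fun x => hclamp N _) hβ
    have heW := integrable_exp_of_bounded (μ := μ) hWc.measurable (fun x => hclamp N _) hβ
    calc ∫ x, Real.exp (β * W x) ∂μ ≤ ∫ x, (Real.exp (β * U x) + K * |U x - W x|) ∂μ :=
          integral_mono heW (heU.add ((hUi.sub hWi).abs.const_mul K))
            fun x => exp_mul_le_exp_mul_add hβ.le (abs_le.1 (hclamp N _)).2
      _ = ∫ x, Real.exp (β * U x) ∂μ + K * ∫ x, |U x - W x| ∂μ := by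
          rw [integral_add heU (hUWi.const_mul K), integral_const_mul]
      _ ≤ (∫ x, Real.exp (β * V x) ∂μ + ε / 2) + K * (ε / 2 / K) := by
          gcongr
          exact hUW.trans (min_le_right _ _)
      _ = _ := by field_simp; ring

end Approximation

/-! ### Occupation times, passage to general potentials, and the theorem. -/

section MainTheorem

variable {𝓧 Ω : Type*} [TopologicalSpace 𝓧] [PolishSpace 𝓧] [MeasurableSpace 𝓧]
    [BorelSpace 𝓧] {mΩ : MeasurableSpace Ω} {ℱ : Filtration ℝ≥0 mΩ} {X : ℝ≥0 → Ω → 𝓧}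
    {P : 𝓧 → Measure Ω} {p : ℝ≥0 → Kernel 𝓧 𝓧}

namespace IsCadlagMarkovFamily

variable (hX : IsCadlagMarkovFamily ℱ X P p) {μ : Measure 𝓧} [IsProbabilityMeasure μ]
  (hμ : ∀ t, (p t).Invariant μ)
include hX hμ

/-- Tonelli and stationarity: X_s has law μ at every time s. -/
theorem lintegral_occupation (t : ℝ≥0) {ψ : 𝓧 → ℝ≥0∞} (hψ : Measurable ψ) :
    ∫⁻ ω, (∫⁻ s in Set.Ioc (0 : ℝ) t, ψ (X s.toNNReal ω)) ∂hX.pathMeasure μ =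
      .ofReal t * ∫⁻ x, ψ x ∂μ := by
  have hm : Measurable fun q : Ω × ℝ => ψ (X q.2.toNNReal q.1) :=
    (hψ.comp hX.measurable_uncurry).comp measurable_swap
  rw [lintegral_lintegral_swap hm.aemeasurable]
  simp only [fun s => (hX.measurePreserving hμ s).lintegral_comp hψ]
  simp [mul_comm]

/-- A μ-null set has zero expected occupation time, so almost every path spends zero time where f
and g differ. -/
theorem ae_ae_path_eq (t : ℝ≥0) {β : Type*} {f g : 𝓧 → β} (hfg : f =ᵐ[μ] g) :
    ∀ᵐ ω ∂hX.pathMeasure μ, ∀ᵐ s ∂volume.restrict (Set.Ioc (0 : ℝ) t),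
      f (X s.toNNReal ω) = g (X s.toNNReal ω) := by
  set N := toMeasurable μ {x | f x ≠ g x}
  have hN : MeasurableSet N := measurableSet_toMeasurable _ _
  have h0 : μ N = 0 := by rw [measure_toMeasurable]; exact hfg
  have hψ : Measurable (N.indicator (1 : 𝓧 → ℝ≥0∞)) := measurable_one.indicator hN
  have h := hX.lintegral_occupation hμ t hψ
  have hm : Measurable fun q : Ω × ℝ => N.indicator (1 : 𝓧 → ℝ≥0∞) (X q.2.toNNReal q.1) :=
    (hψ.comp hX.measurable_uncurry).comp measurable_swap
  rw [lintegral_indicator_one hN, h0, mul_zero, lintegral_eq_zero_iff hm.lintegral_prod_right'] at h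
  filter_upwards [h] with ω hω
  simp only [Pi.zero_apply] at hω
  change ∫⁻ s in Set.Ioc (0 : ℝ) t, (N.indicator 1 ∘ fun s : ℝ => X s.toNNReal ω) s = 0 at hω
  rw [lintegral_eq_zero_iff (hψ.comp (hX.measurable_path ω))] at hω
  filter_upwards [hω] with s hs
  by_contra hne
  have : X s.toNNReal ω ∈ N := subset_toMeasurable _ _ hne
  simp [this] at hs

/-- The L¹ errors are summable, so Σ |W_n - V| is μ-integrable and hence time-integrable along
almost every path. Its terms then tend to 0 in L¹(0,t) without passing to a subsequence. -/
theorem ae_tendsto_timeIntegral (t : ℝ≥0) {V : 𝓧 → ℝ} (hVm : Measurable V) (hV : Integrable V μ)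
    {W : ℕ → 𝓧 → ℝ} (hWm : ∀ n, Measurable (W n))
    (hWi : ∀ n, Integrable (W n) μ) (hW : ∀ n, ∫ x, |V x - W n x| ∂μ ≤ (1 / 2) ^ n) :
    ∀ᵐ ω ∂hX.pathMeasure μ,
      IntervalIntegrable (fun s : ℝ => V (X s.toNNReal ω)) volume 0 t ∧
      Tendsto (fun n => ∫ s in (0 : ℝ)..t, W n (X s.toNNReal ω)) atTop
        (𝓝 (∫ s in (0 : ℝ)..t, V (X s.toNNReal ω))) := by
  have hint : ∀ {U : 𝓧 → ℝ}, Measurable U → Integrable U μ → ∀ᵐ ω ∂hX.pathMeasure μ,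
      IntegrableOn (fun s : ℝ => U (X s.toNNReal ω)) (Set.Ioc 0 t) := by
    intro U hUm hU
    have h := hX.lintegral_occupation hμ t hUm.enorm
    have hm : Measurable fun q : Ω × ℝ => ‖U (X q.2.toNNReal q.1)‖ₑ :=
      (hUm.enorm.comp hX.measurable_uncurry).comp measurable_swap
    have hlt := ae_lt_top hm.lintegral_prod_right'
      (h.trans_ne (ENNReal.mul_ne_top (by simp) hU.2.ne))
    filter_upwards [hlt] with ω hω
    exact ⟨(hUm.comp (hX.measurable_path ω)).aestronglyMeasurable, hω⟩
  have hdm : ∀ n, Measurable fun x => ‖W n x - V x‖ₑ := fun n => ((hWm n).sub hVm).enorm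
  have hd : Measurable fun x => ∑' n, ‖W n x - V x‖ₑ := Measurable.tsum hdm
  have hdi : ∫⁻ x, ∑' n, ‖W n x - V x‖ₑ ∂μ ≠ ∞ := by
    rw [lintegral_tsum fun n => (hdm n).aemeasurable]
    have hle : ∀ n, ∫⁻ x, ‖W n x - V x‖ₑ ∂μ ≤ .ofReal ((1 / 2) ^ n) := fun n => by
      rw [← ofReal_integral_norm_eq_lintegral_enorm (f := fun x => W n x - V x) ((hWi n).sub hV)]
      refine ENNReal.ofReal_le_ofReal (le_trans (le_of_eq ?_) (hW n))
      simp only [Real.norm_eq_abs, abs_sub_comm]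
    refine ((ENNReal.tsum_le_tsum hle).trans_lt ?_).ne
    rw [← ENNReal.ofReal_tsum_of_nonneg (fun n => by positivity) summable_geometric_two]
    exact ENNReal.ofReal_lt_top
  have h := hX.lintegral_occupation hμ t hd
  have hm : Measurable fun q : Ω × ℝ => ∑' n, ‖W n (X q.2.toNNReal q.1) - V (X q.2.toNNReal q.1)‖ₑ :=
    (hd.comp hX.measurable_uncurry).comp measurable_swap
  have hlt := ae_lt_top hm.lintegral_prod_right' (h.trans_ne (ENNReal.mul_ne_top (by simp) hdi))
  filter_upwards [hint hVm hV, ae_all_iff.2 fun n => hint (hWm n) (hWi n), hlt] with ω h1 h2 h3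
  refine ⟨(intervalIntegrable_iff_integrableOn_Ioc_of_le t.coe_nonneg).2 h1, ?_⟩
  simp only [intervalIntegral.integral_of_le t.coe_nonneg]
  refine tendsto_integral_of_L1 _ h1.1 (.of_forall h2) ?_
  have hp : ∀ n, Measurable fun s : ℝ => ‖W n (X s.toNNReal ω) - V (X s.toNNReal ω)‖ₑ := fun n =>
    (hdm n).comp (hX.measurable_path ω)
  rw [lintegral_tsum fun n => (hp n).aemeasurable] at h3
  exact ENNReal.tendsto_atTop_zero_of_tsum_ne_top h3.ne

variable {β : ℝ} (hβ : 0 < β) (hLS : LogSobolevInequality X P μ β)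
include hβ hLS

/-- Fatou under P x for fixed x, then under μ. The constants converge because the approximants
satisfy ∫ e^{βW_n} dμ ≤ ∫ e^{βV} dμ + 2⁻ⁿ. -/
theorem lintegral_sq_le_of_integrable (t : ℝ≥0) {V : 𝓧 → ℝ} (hVm : Measurable V)
    (hV : Integrable V μ) (hexp : Integrable (fun x => Real.exp (β * V x)) μ)
    {φ : 𝓧 → ℝ≥0∞} (hφ : Measurable φ) :
    ∫⁻ x, (∫⁻ ω, φ (X t ω) * .ofReal (expFunctional X V t ω) ∂P x) ^ 2 ∂μ ≤
      .ofReal ((∫ x, Real.exp (β * V x) ∂μ) ^ ((t : ℝ) / β)) ^ 2 * ∫⁻ x, φ x ^ 2 ∂μ := by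
  choose W C hWc hWC hW1 hW2 using fun n : ℕ =>
    exists_bounded_continuous_approx hβ hVm hV hexp (ε := (1 / 2) ^ n) (by positivity)
  have hpos := integral_exp_pos hexp
  have hae := ae_ae_of_ae_mixture (hX.aemeasurable_apply μ) (hX.ae_tendsto_timeIntegral hμ t hVm hV
    (fun n => (hWc n).measurable) (fun n => Integrable.of_bound
      (hWc n).measurable.aestronglyMeasurable (C n) (ae_of_all _ (hWC n))) hW1)
  have hWm : ∀ n, Measurable fun ω => φ (X t ω) * .ofReal (expFunctional X (W n) t ω) := fun n =>
    (hφ.comp (hX.measurable t)).mul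
      (hX.measurable_expFunctional (hWc n).measurable t).ennreal_ofReal
  have hlim : Tendsto (fun n : ℕ => ENNReal.ofReal ((∫ x, Real.exp (β * V x) ∂μ + (1 / 2) ^ n) ^
      ((t : ℝ) / β)) ^ 2 * ∫⁻ x, φ x ^ 2 ∂μ) atTop
      (𝓝 (.ofReal ((∫ x, Real.exp (β * V x) ∂μ) ^ ((t : ℝ) / β)) ^ 2 * ∫⁻ x, φ x ^ 2 ∂μ)) := by
    refine ENNReal.Tendsto.mul_const (ENNReal.Tendsto.pow (ENNReal.tendsto_ofReal ?_)) (.inl ?_)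
    · have h0 : Tendsto (fun n : ℕ => ((1 : ℝ) / 2) ^ n) atTop (𝓝 0) :=
        tendsto_pow_atTop_nhds_zero_of_lt_one (by norm_num) (by norm_num)
      have h1 := h0.const_add (∫ x, Real.exp (β * V x) ∂μ)
      rw [add_zero] at h1
      exact h1.rpow_const (.inl hpos.ne')
    · have : 0 < (∫ x, Real.exp (β * V x) ∂μ) ^ ((t : ℝ) / β) := Real.rpow_pos_of_pos hpos _
      simpa using this
  have hsq : Monotone fun a : ℝ≥0∞ => a ^ 2 := fun a b h => pow_le_pow_left' h 2
  calc _ ≤ ∫⁻ x, liminf (fun n => (∫⁻ ω, φ (X t ω) * .ofReal (expFunctional X (W n) t ω) ∂P x) ^ 2)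
          atTop ∂μ := by
        refine lintegral_mono_ae ?_
        filter_upwards [hae] with x hx
        have h1 : ∫⁻ ω, φ (X t ω) * .ofReal (expFunctional X V t ω) ∂P x ≤
            liminf (fun n => ∫⁻ ω, φ (X t ω) * .ofReal (expFunctional X (W n) t ω) ∂P x) atTop := by
          refine le_trans (lintegral_mono_ae ?_) (lintegral_liminf_le hWm)
          filter_upwards [hx] with ω hω
          refine le_of_eq (Tendsto.liminf_eq ?_).symm
          -- φ may be infinite; multiplication by it is still continuous at the limit because the
          -- exponential is nonzero.
          refine ENNReal.Tendsto.const_mul (ENNReal.tendsto_ofReal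
            ((Real.continuous_exp.tendsto _).comp hω.2)) (.inl ?_)
          exact (ENNReal.ofReal_pos.2 (Real.exp_pos _)).ne'
        refine (hsq h1).trans (le_of_eq ?_)
        exact hsq.map_liminf_of_continuousAt _ (ENNReal.continuous_pow 2).continuousAt
    _ ≤ liminf (fun n => ∫⁻ x, (∫⁻ ω, φ (X t ω) * .ofReal (expFunctional X (W n) t ω) ∂P x) ^ 2 ∂μ)
          atTop := lintegral_liminf_le' fun n =>
        (aemeasurable_lintegral_of_measurable (hX.aemeasurable_apply μ) (hWm n)).pow_const 2
    _ ≤ liminf (fun n : ℕ => ENNReal.ofReal ((∫ x, Real.exp (β * V x) ∂μ + (1 / 2) ^ n) ^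
      ((t : ℝ) / β)) ^ 2 * ∫⁻ x, φ x ^ 2 ∂μ) atTop := by
        refine liminf_le_liminf (.of_forall fun n => ?_)
        refine (hX.lintegral_sq_le_of_logSobolev hμ (hWc n) (hWC n) hβ hLS t hφ).trans ?_
        gcongr
        exact hW2 n
    _ = _ := hlim.liminf_eq

end IsCadlagMarkovFamily

end MainTheorem

theorem mainTheorem7 {𝓧 Ω : Type*} [TopologicalSpace 𝓧] [PolishSpace 𝓧] [MeasurableSpace 𝓧]
    [BorelSpace 𝓧] {mΩ : MeasurableSpace Ω} (ℱ : Filtration ℝ≥0 mΩ) (X : ℝ≥0 → Ω → 𝓧)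
    (P : 𝓧 → Measure Ω) (p : ℝ≥0 → Kernel 𝓧 𝓧) (hX : IsCadlagMarkovFamily ℱ X P p)
    (μ : Measure 𝓧) [IsProbabilityMeasure μ] (hμ : ∀ t, (p t).Invariant μ)
    (β : ℝ) (hβ : 0 < β) (hLS : LogSobolevInequality X P μ β)
    (V : 𝓧 → ℝ) (hV : Integrable V μ) (hexp : Integrable (fun x => Real.exp (β * V x)) μ)
    (t : ℝ≥0) :
    ∃ T : Lp ℂ 2 μ →L[ℂ] Lp ℂ 2 μ,
      (∀ V' : 𝓧 → ℝ, V' =ᵐ[μ] V → ∀ (g : 𝓧 → ℂ) (hg : MemLp g 2 μ),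
        (∀ᵐ x ∂μ,
          (∀ᵐ ω ∂(P x), IntervalIntegrable (fun s : ℝ => V' (X s.toNNReal ω)) volume 0 t) ∧
          Integrable (feynmanKacIntegrand X V' t g) (P x)) ∧
        T (hg.toLp g) =ᵐ[μ] feynmanKac X P V' t g) ∧
      ‖T‖ ≤ (∫ x, Real.exp (β * V x) ∂μ) ^ ((t : ℝ) / β) := by
  -- One Borel version V₀ defines the operator. Every other version V' gives the same time integral
  -- along almost every path.
  obtain ⟨V₀, hV₀m, hVV₀⟩ : ∃ V₀ : 𝓧 → ℝ, Measurable V₀ ∧ V =ᵐ[μ] V₀ :=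
    ⟨hV.1.mk V, hV.1.stronglyMeasurable_mk.measurable, hV.1.ae_eq_mk⟩
  have hee : (fun x => Real.exp (β * V x)) =ᵐ[μ] fun x => Real.exp (β * V₀ x) :=
    hVV₀.mono fun x hx => by simp only [hx]
  have hV₀ := hV.congr hVV₀
  have hexp₀ := hexp.congr hee
  rw [integral_congr_ae hee]
  have hb := fun φ (hφ : Measurable φ) =>
    hX.lintegral_sq_le_of_integrable hμ hβ hLS t hV₀m hV₀ hexp₀ (φ := φ) hφ
  have hP := hX.aemeasurable_apply μ
  have hXm := hX.measurable t
  have hZm := hX.measurable_expFunctional hV₀m t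
  obtain ⟨T, hT1, hT2⟩ := exists_weighted_operator (𝕜 := ℂ) hP hXm hZm (expFunctional_nonneg V₀ t)
    hb (Real.rpow_nonneg (integral_exp_pos hexp₀).le _)
  refine ⟨T, fun V' hV' g hg => ?_, hT1⟩
  have hint := integrable_weighted hP hXm hZm (expFunctional_nonneg V₀ t) hb hg
  have hpath := hX.ae_ae_path_eq hμ t (hV'.trans hVV₀)
  -- The constant sequence W_n = V₀ is used only to extract integrability of V₀ along paths.
  have hII := hX.ae_tendsto_timeIntegral hμ t hV₀m hV₀ (W := fun _ => V₀) (fun _ => hV₀m)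
    (fun _ => hV₀) (fun n => by simp)
  have hG : ∀ᵐ ω ∂hX.pathMeasure μ, feynmanKacIntegrand X V' t g ω =
      g (X t ω) * (expFunctional X V₀ t ω : ℂ) := by
    filter_upwards [hpath] with ω hω
    have : ∫ s in (0 : ℝ)..t, V' (X s.toNNReal ω) = ∫ s in (0 : ℝ)..t, V₀ (X s.toNNReal ω) := by
      simp only [intervalIntegral.integral_of_le t.coe_nonneg]
      exact integral_congr_ae hω
    rw [feynmanKacIntegrand, this, expFunctional]
  have hGx := ae_ae_of_ae_mixture hP hG
  refine ⟨?_, ?_⟩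
  · have hII' : ∀ᵐ ω ∂hX.pathMeasure μ,
        IntervalIntegrable (fun s : ℝ => V' (X s.toNNReal ω)) volume 0 t := by
      filter_upwards [hpath, hII] with ω h1 h2
      refine h2.1.congr_ae ?_
      rw [Set.uIoc_of_le t.coe_nonneg]
      exact h1.mono fun s hs => hs.symm
    filter_upwards [ae_ae_of_ae_mixture hP hII', hGx, ae_integrable_of_mixture hP hint]
      with x h1 h2 h3
    exact ⟨h1, h3.congr (h2.mono fun ω h => h.symm)⟩
  · refine (hT2 g hg).trans ?_
    filter_upwards [hGx] with x hx
    exact integral_congr_ae (hx.mono fun ω h => h.symm)
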